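/- Let $0<\alpha<1$ and $L>0$, and let $C_\alpha=\frac{\alpha 2^{\alpha-1}\Gamma(\frac{1+\alpha}{2})}{\pi^{1/2}\Gamma(1-\frac{\alpha}{2})}$. Let $u:\mathbb R\to\mathbb R$ solve $$(-\Delta)^{\alpha/2}u(x):=C_\alpha\,\mathrm{P.V.}\!\int_{\mathbb R}\frac{u(x)-u(y)}{|x-y|^{1+\alpha}}\,dy=f(x)\quad (0<x<2L),\qquad u=0\ \text{ on } (-\infty,0]\cup[2L,\infty).$$ Assume $u\in C^2(0,2L)$ and, for some $0<\sigma\le\alpha/2$ and some $K$, $$|u^{(\ell)}(x)|\le K\,[x(2L-x)]^{\sigma-\ell},\qquad 0<x<2L,\ \ell=0,1,2.$$ For $\kappa\ge 1$ and an even integer $N\ge2$ take the symmetric graded grid $x_i=L(2i/N)^\kappa$ for $0\le i\le N/2$, $x_i=2L-L(2-2i/N)^\kappa$ for $N/2<i\le N$, with step sizes $h_i=x_i-x_{i-1}$. For $v=(v_0,\dots,v_N)$ let $\Pi_hv=\sum_{j=1}^{N-1}v_j\phi_j$, where $\phi_j$ are the piecewise linear nodal (hat) functions, extended by $0$ outside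 $[0,2L]$. Let $0<\Delta x\le\min_j h_j$ and $X\ge 2L$, and let $\lambda_s,\theta_s>0$ ($1\le s\le N_e$, $N_e\ge1$) be a sum-of-exponentials approximation with tolerance $\varepsilon>0$, i.e. $\big|t^{-1-\alpha}-\sum_{s=1}^{N_e}\theta_se^{-\lambda_st}\big|\le\varepsilon$ for all $t\in[\Delta x,X]$. The fast collocation scheme is: find $U_0,\dots,U_N$ with $U_0=U_N=0$ and $\mathcal L_h[U]_i=f(x_i)$ for $1\le i\le N-1$, where $$\mathcal L_h[v]_i=C_\alpha\Big\{-\tfrac1{1-\alpha}\Big(h_i^{-\alpha}v_{i-1}-\tfrac{h_i^{-\alpha}+h_{i+1}^{-\alpha}}{\alpha}v_i+h_{i+1}^{-\alpha}v_{i+1}\Big)-\sum_{s=1}^{N_e}\theta_s\!\int_{-\infty}^{x_{i-1}}\!\!e^{-\lambda_s(x_i-y)}\Pi_hv(y)\,dy-\sum_{s=1}^{N_e}\theta_s\!\int_{x_{i+1}}^{\infty}\!\!e^{-\lambda_s(y-x_i)}\Pi_hv(y)\,dy\Big\}.$$ Then there is $\varepsilon_0>0$, depending only on $\alpha$ and $L$,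 and a constant $c>0$, depending only on $\alpha,L,\sigma,\kappa,K$, such that whenever $0<\varepsilon\le\varepsilon_0$ the scheme has exactly one solution $(U_i)_{i=0}^N$, and $$\max_{1\le i\le N-1}|u(x_i)-U_i|\le c\cdot\begin{cases}N^{-\kappa\sigma}+\varepsilon,&\kappa(1+\sigma)<2,\\ N^{-\kappa\sigma}\ln N+\varepsilon,&\kappa(1+\sigma)=2,\\ N^{-\min\{\kappa\sigma,\,2-\alpha\}}+\varepsilon,&\kappa(1+\sigma)>2.\end{cases}$$ -/

import Mathlib

open Set Filter Topology MeasureTheory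

namespace FastCollocation

noncomputable section

/-- The normalization constant `C_α` of the one-dimensional fractional Laplacian of order `α`. -/
def normConst (α : ℝ) : ℝ :=
  α * 2 ^ (α - 1) * Real.Gamma ((1 + α) / 2) / (Real.sqrt Real.pi * Real.Gamma (1 - α / 2))

/-- `(-Δ)^{α/2} u (x)` exists and equals `v`, in the hypersingular (principal value) sense:
the truncated integrals over `|x - y| > δ` converge absolutely, and `C_α` times them tends
to `v` as `δ ↓ 0`. -/
def HasFracLaplacianAt (α : ℝ) (u : ℝ → ℝ) (x v : ℝ) : Prop :=
  (∀ δ : ℝ, 0 < δ →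
    IntegrableOn (fun y : ℝ => (u x - u y) / |x - y| ^ (1 + α)) {y : ℝ | δ < |x - y|}) ∧
  Tendsto
    (fun δ : ℝ => normConst α *
      ∫ y in {y : ℝ | δ < |x - y|}, (u x - u y) / |x - y| ^ (1 + α))
    (𝓝[>] 0) (𝓝 v)

/-- The nonlocal Dirichlet problem `(-Δ)^{α/2} u = f` in `(a, b)`, `u = 0` outside `(a, b)`. -/
structure IsDirichletSolution (α a b : ℝ) (f u : ℝ → ℝ) : Prop where
  eqn : ∀ x ∈ Ioo a b, HasFracLaplacianAt α u x (f x)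
  exterior : ∀ x : ℝ, x ≤ a ∨ b ≤ x → u x = 0

/-- The boundary-singularity bound `|u^{(ℓ)}(x)| ≤ K [(x - a)(b - x)]^{σ - ℓ}` on `(a, b)`
for `ℓ = 0, 1, 2`. -/
def HasBoundarySingularity (a b σ K : ℝ) (u : ℝ → ℝ) : Prop :=
  ∀ ℓ : ℕ, ℓ ≤ 2 → ∀ x ∈ Ioo a b,
    |iteratedDeriv ℓ u x| ≤ K * ((x - a) * (b - x)) ^ (σ - (ℓ : ℝ))

/-- The symmetric graded grid on `(0, 2L)` with grading parameter `κ`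
(only the nodes `0 ≤ i ≤ N`, with `N` even, are used). -/
def gradedGrid (L κ : ℝ) (N i : ℕ) : ℝ :=
  if 2 * i ≤ N then L * (2 * (i : ℝ) / (N : ℝ)) ^ κ
  else 2 * L - L * (2 - 2 * (i : ℝ) / (N : ℝ)) ^ κ

/-- The step size `h_j = x_j - x_{j-1}`, for `j ≥ 1`. -/
def step (x : ℕ → ℝ) (j : ℕ) : ℝ := x j - x (j - 1)

/-- The linear nodal basis function `φ_j` of the grid `x`, for `j ≥ 1`. -/
def hat (x : ℕ → ℝ) (j : ℕ) (y : ℝ) : ℝ :=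
  if x (j - 1) ≤ y ∧ y ≤ x j then (y - x (j - 1)) / (x j - x (j - 1))
  else if x j ≤ y ∧ y ≤ x (j + 1) then (x (j + 1) - y) / (x (j + 1) - x j)
  else 0

/-- The piecewise linear function `Π_h v = ∑_{j=1}^{N-1} v_j φ_j`. -/
def interp (x : ℕ → ℝ) (N : ℕ) (v : ℕ → ℝ) (y : ℝ) : ℝ :=
  ∑ j ∈ Finset.Icc 1 (N - 1), v j * hat x j y

/-- `∑_s θ_s e^{-lam_s t}` is a sum-of-exponentials approximation of `t^{-β}` on `[Δx, X]` with
positive nodes and weights and absolute tolerance `ε`. -/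
structure IsSOE (β ε Δx X : ℝ) (Ne : ℕ) (lam θ : Fin Ne → ℝ) : Prop where
  card_pos : 0 < Ne
  node_pos : ∀ s, 0 < lam s
  weight_pos : ∀ s, 0 < θ s
  approx : ∀ t ∈ Icc Δx X, |t ^ (-β) - ∑ s, θ s * Real.exp (-(lam s) * t)| ≤ ε

/-- The left history integral `S^L_{i}[v]` for the exponent `l`. -/
def histL (x : ℕ → ℝ) (N : ℕ) (l : ℝ) (v : ℕ → ℝ) (i : ℕ) : ℝ :=
  ∫ y in Iic (x (i - 1)), Real.exp (-l * (x i - y)) * interp x N v y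

/-- The right history integral `S^R_{i}[v]` for the exponent `l`. -/
def histR (x : ℕ → ℝ) (N : ℕ) (l : ℝ) (v : ℕ → ℝ) (i : ℕ) : ℝ :=
  ∫ y in Ici (x (i + 1)), Real.exp (-l * (y - x i)) * interp x N v y

/-- The discrete operator `𝓛_h[v]_i` of the (original) fast collocation scheme, `α ∈ (0, 1)`. -/
def fastOp (α : ℝ) (x : ℕ → ℝ) (N : ℕ) {Ne : ℕ} (lam θ : Fin Ne → ℝ) (v : ℕ → ℝ) (i : ℕ) : ℝ :=
  normConst α *
    (-(1 / (1 - α)) *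
        (step x i ^ (-α) * v (i - 1)
          - (step x i ^ (-α) + step x (i + 1) ^ (-α)) / α * v i
          + step x (i + 1) ^ (-α) * v (i + 1))
      - ∑ s, θ s * histL x N (lam s) v i
      - ∑ s, θ s * histR x N (lam s) v i)

/-- `U_0, …, U_N` solves the fast collocation scheme: `𝓛_h[U]_i = f(x_i)` for `1 ≤ i ≤ N - 1`
and `U_0 = U_N = 0` (the values `U_i` with `i > N` play no role). -/
structure IsFastSolution (α : ℝ) (x : ℕ → ℝ) (N : ℕ) {Ne : ℕ} (lam θ : Fin Ne → ℝ)
    (f : ℝ → ℝ) (U : ℕ → ℝ) : Prop where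
  eqn : ∀ i ∈ Finset.Icc 1 (N - 1), fastOp α x N lam θ U i = f (x i)
  left : U 0 = 0
  right : U N = 0

end

end FastCollocation

namespace FastCollocation

/-! ### One-sided integrals against the kernel `t ^ (-(1 + α))` -/

/-! The proof is consistency plus stability, both measured against the weight `rowWeight`, which is
half of the kernel mass `C_α ∫ |x - y|^(-1-α) dy` lying outside `(0, 2L)`.

Stability (`IsMesh.stability`) is a discrete maximum principle. At a node where `v` attains `max
|v|`, the diagonal coefficient dominates all the others, and its surplus is the kernel mass outside
the domain minus at most `ε` times the length of the domain. For `ε ≤ tolBound` the second quantity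
is at most half of the first. Hence `|fastOp v| ≤ B * rowWeight` at the interior nodes implies `max
|v| ≤ B`. With `B = 0` this gives uniqueness and, by finite-dimensional linear algebra, existence.

Consistency (`IsMesh.truncation_error`): apart from the exponential sum, the scheme integrates the
exact kernel against the piecewise linear interpolant of `u`, so the truncation error is the
singular integral of the interpolation error plus `O(ε)`. Let `X_n = L (n/M)^κ` with `N = 2M`. On a
cell of distance index `n` the step is comparable to `X_n / n`, so the bounds on `u` and its
derivatives give an interpolation error `O(X_n^σ / n^2)`, which is `O(M^(-γ) n^(-α))` for every `γ ≤
min (κσ) (2 - α)`.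

Seen from a node of distance index `m` and boundary distance `D = X_m` (`abs_interp_error_le`), the
error closer than `D/2` is `O(M^(-γ) m^(-α))` and decays linearly to zero at the node on the scale
`r = D/m`; it contributes `M^(-γ) m^(-α) r^(-α) = M^(-γ) D^(-α)`. Farther away the crude bound
`O(M^(-γ))` meets kernel mass `O(D^(-α))`. Both parts are thus `O(N^(-γ))` times the row weight,
with no sum over cells and hence no logarithm. If `κ(1 + σ) ≤ 2`, then `κσ ≤ 2 - κ ≤ 1 < 2 - α`, so
`γ = κσ` is admissible in all but the third case, where the minimum is taken. -/

theorem integrableOn_kernel {α h : ℝ} (hα : 0 < α) (hh : 0 < h) :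
    IntegrableOn (fun t : ℝ => t ^ (-(1 + α))) (Ioi h) :=
  integrableOn_Ioi_rpow_of_lt (by linarith) hh

theorem integral_kernel {α h : ℝ} (hα : 0 < α) (hh : 0 < h) :
    ∫ t in Ioi h, t ^ (-(1 + α)) = h ^ (-α) / α := by
  rw [integral_Ioi_rpow_of_lt (by linarith) hh]
  rw [show -(1 + α) + 1 = -α by ring, neg_div_neg_eq]

theorem integrableOn_bdd_kernel {α h V : ℝ} (hα : 0 < α) (hh : 0 < h) {p : ℝ → ℝ}
    (hp : Measurable p) (hb : ∀ t, |p t| ≤ V) :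
    IntegrableOn (fun t : ℝ => p t * t ^ (-(1 + α))) (Ioi h) := by
  refine Integrable.bdd_mul (c := V) (integrableOn_kernel hα hh) hp.aestronglyMeasurable ?_
  exact Eventually.of_forall fun t => by simpa using hb t

theorem integral_linear_kernel {α δ h w : ℝ} (hα1 : α < 1) (hδ : 0 < δ) (hδh : δ ≤ h)
    {q : ℝ → ℝ} (hq : ∀ t ∈ Ioc δ h, q t = w * (t / h)) :
    ∫ t in Ioc δ h, q t * t ^ (-(1 + α))
      = w / h * ((h ^ (1 - α) - δ ^ (1 - α)) / (1 - α)) := by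
  have h1 : ∫ t in Ioc δ h, q t * t ^ (-(1 + α)) = ∫ t in Ioc δ h, w / h * t ^ (-α) := by
    refine setIntegral_congr_fun measurableSet_Ioc fun t ht => ?_
    have ht0 : 0 < t := hδ.trans ht.1
    simp only [hq t ht]
    rw [show -(1 + α) = -α - 1 by ring, Real.rpow_sub_one ht0.ne']
    field_simp
  rw [h1, ← intervalIntegral.integral_of_le hδh, intervalIntegral.integral_const_mul,
    integral_rpow (Or.inl (by linarith))]
  rw [show -α + 1 = 1 - α by ring]

/-- The truncated one-sided hypersingular integral of a profile that is linear near `0`. -/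
theorem integral_profile {α δ h v₀ v₁ V : ℝ} (hα : 0 < α) (hα1 : α < 1) (hδ : 0 < δ)
    (hδh : δ < h) {p : ℝ → ℝ} (hp : Measurable p) (hb : ∀ t, |p t| ≤ V)
    (hlin : ∀ t ∈ Icc 0 h, p t = v₀ + (v₁ - v₀) * (t / h)) :
    ∫ t in Ioi δ, (v₀ - p t) * t ^ (-(1 + α))
      = (v₀ - v₁) / h * ((h ^ (1 - α) - δ ^ (1 - α)) / (1 - α)) + v₀ * (h ^ (-α) / α)
        - ∫ t in Ioi h, p t * t ^ (-(1 + α)) := by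
  have hh : 0 < h := hδ.trans hδh
  have hint : IntegrableOn (fun t => (v₀ - p t) * t ^ (-(1 + α))) (Ioi δ) := by
    refine integrableOn_bdd_kernel (V := |v₀| + V) hα hδ (measurable_const.sub hp) fun t => ?_
    exact (abs_sub _ _).trans (by gcongr; exact hb t)
  rw [← Ioc_union_Ioi_eq_Ioi hδh.le,
    setIntegral_union Ioc_disjoint_Ioi_same measurableSet_Ioi
      (hint.mono_set Ioc_subset_Ioi_self) (hint.mono_set (Ioi_subset_Ioi hδh.le)),
    integral_linear_kernel (w := v₀ - v₁) hα1 hδ hδh.le, add_sub_assoc]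
  · congr 1
    simp_rw [sub_mul]
    rw [integral_sub ((integrableOn_kernel hα hh).const_mul _)
      (integrableOn_bdd_kernel hα hh hp hb), integral_const_mul, integral_kernel hα hh]
  · intro t ht
    rw [hlin t ⟨hδ.le.trans ht.1.le, ht.2⟩]; ring

/-- Integrals over `{y | δ < |x - y|}` split into two one-sided integrals. -/
theorem integral_outside {δ x : ℝ} (hδ : 0 < δ) {F : ℝ → ℝ}
    (hF : IntegrableOn F {y : ℝ | δ < |x - y|}) :
    ∫ y in {y : ℝ | δ < |x - y|}, F y
      = (∫ t in Ioi δ, F (x - t)) + ∫ t in Ioi δ, F (x + t) := by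
  have hset : {y : ℝ | δ < |x - y|} = Iio (x - δ) ∪ Ioi (x + δ) := by
    ext y
    simp only [mem_ofPred_eq, lt_abs, mem_union, mem_Iio, mem_Ioi]
    constructor <;> rintro (h | h) <;> [left; right; left; right] <;> linarith
  rw [hset] at hF ⊢
  have hd : Disjoint (Iio (x - δ)) (Ioi (x + δ)) := by
    rw [Set.disjoint_left]; intro y hy hy'; simp only [mem_Iio, mem_Ioi] at hy hy'; linarith
  rw [setIntegral_union hd measurableSet_Ioi (hF.mono_set subset_union_left)
    (hF.mono_set subset_union_right)]
  congr 1
  · have := (Measure.measurePreserving_sub_left volume x).setIntegral_preimage_emb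
      (MeasurableEquiv.subLeft x).measurableEmbedding F (Iio (x - δ))
    rw [← this]; congr 2; ext t; simp
  · have := (measurePreserving_add_left volume x).setIntegral_preimage_emb
      (MeasurableEquiv.addLeft x).measurableEmbedding F (Ioi (x + δ))
    rw [← this]; congr 2; ext t; simp

theorem integrableOn_outside {δ x : ℝ} {F : ℝ → ℝ}
    (hF : IntegrableOn F {y : ℝ | δ < |x - y|}) :
    IntegrableOn (fun t => F (x - t)) (Ioi δ) ∧ IntegrableOn (fun t => F (x + t)) (Ioi δ) := by
  have hL : Iio (x - δ) ⊆ {y : ℝ | δ < |x - y|} := fun y hy => by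
    simp only [mem_ofPred_eq, lt_abs, mem_Iio] at *; left; linarith
  have hR : Ioi (x + δ) ⊆ {y : ℝ | δ < |x - y|} := fun y hy => by
    simp only [mem_ofPred_eq, lt_abs, mem_Ioi] at *; right; linarith
  constructor
  · have := ((Measure.measurePreserving_sub_left volume x).integrableOn_comp_preimage
      (MeasurableEquiv.subLeft x).measurableEmbedding).2 (hF.mono_set hL)
    rwa [show (fun t => x - t) ⁻¹' Iio (x - δ) = Ioi δ by ext t; simp] at this
  · have := ((measurePreserving_add_left volume x).integrableOn_comp_preimage
      (MeasurableEquiv.addLeft x).measurableEmbedding).2 (hF.mono_set hR)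
    rwa [show (fun t => x + t) ⁻¹' Ioi (x + δ) = Ioi δ by ext t; simp] at this

theorem integrable_integral_near {α r : ℝ} (hα1 : α < 1) (hr : 0 < r) :
    IntegrableOn (fun t : ℝ => t / r * t ^ (-(1 + α))) (Ioc 0 r) ∧
      ∫ t in Ioc 0 r, t / r * t ^ (-(1 + α)) = r ^ (-α) / (1 - α) := by
  have hcongr : EqOn (fun t : ℝ => r⁻¹ * t ^ (-α)) (fun t : ℝ => t / r * t ^ (-(1 + α)))
      (Ioc 0 r) := by
    intro t ht
    simp only
    rw [show -(1 + α) = -α - 1 by ring, Real.rpow_sub_one ht.1.ne']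
    have := ht.1.ne'
    field_simp
  have hi : IntegrableOn (fun t : ℝ => r⁻¹ * t ^ (-α)) (Ioc 0 r) := by
    have := intervalIntegral.intervalIntegrable_rpow' (a := 0) (b := r) (r := -α) (by linarith)
    exact ((intervalIntegrable_iff_integrableOn_Ioc_of_le hr.le).1 this).const_mul _
  refine ⟨hi.congr_fun hcongr measurableSet_Ioc, ?_⟩
  rw [← setIntegral_congr_fun measurableSet_Ioc hcongr, integral_const_mul,
    ← intervalIntegral.integral_of_le hr.le, integral_rpow (Or.inl (by linarith)),
    Real.zero_rpow (by linarith), Real.rpow_add_one hr.ne']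
  rw [show -α + 1 = 1 - α by ring]
  field_simp
  ring

/-- Bound of a truncated one-sided integral of a function that is small near `0`. -/
theorem abs_integral_le_of_profile {α δ r d A B : ℝ} (hα : 0 < α) (hα1 : α < 1) (hδ : 0 < δ)
    (hr : 0 < r) (hd : 0 < d) (hA : 0 ≤ A) (hB : 0 ≤ B) {e : ℝ → ℝ}
    (he : ∀ t, 0 < t → |e t| ≤ A * min 1 (t / r) + B * (if d ≤ t then 1 else 0)) :
    |∫ t in Ioi δ, e t * t ^ (-(1 + α))|
      ≤ A * (r ^ (-α) * (1 / (1 - α) + 1 / α)) + B * (d ^ (-α) / α) := by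
  let k : ℝ → ℝ := fun t => t ^ (-(1 + α))
  let g₁ : ℝ → ℝ := (Ioc 0 r).indicator fun t => t / r * k t
  let g₂ : ℝ → ℝ := (Ioi r).indicator k
  let g₃ : ℝ → ℝ := (Ici d).indicator k
  have hα1' : (0 : ℝ) < 1 - α := by linarith
  obtain ⟨hn1, hn2⟩ := integrable_integral_near hα1 hr
  have i1 : Integrable g₁ := (integrable_indicator_iff measurableSet_Ioc).2 hn1
  have i2 : Integrable g₂ := (integrable_indicator_iff measurableSet_Ioi).2
    (integrableOn_kernel hα hr)
  have i3 : Integrable g₃ := (integrable_indicator_iff measurableSet_Ici).2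
    ((integrableOn_Ici_iff_integrableOn_Ioi).2 (integrableOn_kernel hα hd))
  have e1 : ∫ t, g₁ t = r ^ (-α) / (1 - α) := by
    rw [integral_indicator measurableSet_Ioc]; exact hn2
  have e2 : ∫ t, g₂ t = r ^ (-α) / α := by
    rw [integral_indicator measurableSet_Ioi]; exact integral_kernel hα hr
  have e3 : ∫ t, g₃ t = d ^ (-α) / α := by
    rw [integral_indicator measurableSet_Ici, integral_Ici_eq_integral_Ioi]
    exact integral_kernel hα hd
  -- This majorant is integrable on the whole line, so the resulting bound is uniform in `δ`.
  let g : ℝ → ℝ := fun t => A * (g₁ t + g₂ t) + B * g₃ t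
  have ig : Integrable g := ((i1.add i2).const_mul A).add (i3.const_mul B)
  have hg0 : ∀ t, 0 ≤ g t := by
    intro t
    have h1 : 0 ≤ g₁ t := indicator_nonneg (fun s hs => by
      have := hs.1; simp only [k]; positivity) t
    have h2 : 0 ≤ g₂ t := indicator_nonneg (fun s hs => by
      have : 0 < s := hr.trans hs; simp only [k]; positivity) t
    have h3 : 0 ≤ g₃ t := indicator_nonneg (fun s hs => by
      have : 0 < s := hd.trans_le hs; simp only [k]; positivity) t
    simp only [g]; positivity
  have hbound : ∀ t, 0 < t → ‖e t * t ^ (-(1 + α))‖ ≤ g t := by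
    intro t ht
    have hk : 0 ≤ k t := by simp only [k]; positivity
    rw [Real.norm_eq_abs, abs_mul, abs_of_nonneg hk]
    refine (mul_le_mul_of_nonneg_right (he t ht) hk).trans ?_
    simp only [g]
    have c1 : min 1 (t / r) * k t ≤ g₁ t + g₂ t := by
      by_cases h : t ≤ r
      · have : g₁ t = t / r * k t := indicator_of_mem (show t ∈ Ioc 0 r from ⟨ht, h⟩) _
        have h2 : g₂ t = 0 := indicator_of_notMem (by simpa using h) _
        rw [this, h2, add_zero]
        exact mul_le_mul_of_nonneg_right (min_le_right _ _) hk
      · have : g₁ t = 0 := indicator_of_notMem (by simp [h]) _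
        have h2 : g₂ t = k t := indicator_of_mem (by simpa using h) _
        rw [this, h2, zero_add]
        exact (mul_le_mul_of_nonneg_right (min_le_left _ _) hk).trans (by simp)
    have c2 : (if d ≤ t then (1 : ℝ) else 0) * k t ≤ g₃ t := by
      by_cases h : d ≤ t
      · have : g₃ t = k t := indicator_of_mem (by simpa using h) _
        simp [h, this]
      · have : g₃ t = 0 := indicator_of_notMem (by simpa using h) _
        simp [h, this]
    calc _ = A * (min 1 (t / r) * k t) + B * ((if d ≤ t then (1 : ℝ) else 0) * k t) := by
          simp only [k]; ring
      _ ≤ _ := by gcongr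
  have := norm_integral_le_of_norm_le (f := fun t => e t * t ^ (-(1 + α))) (μ := volume.restrict (Ioi δ)) ig.integrableOn
    ((ae_restrict_iff' measurableSet_Ioi).2 (Eventually.of_forall fun t ht =>
      hbound t (hδ.trans ht)))
  rw [Real.norm_eq_abs] at this
  refine this.trans ((setIntegral_le_integral ig (Eventually.of_forall hg0)).trans (le_of_eq ?_))
  simp only [g]
  have i12 : Integrable fun t => A * (g₁ t + g₂ t) := (i1.add i2).const_mul A
  rw [integral_add i12 (i3.const_mul B), integral_const_mul,
    integral_const_mul, integral_add i1 i2, e1, e2, e3]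
  field_simp

/-! ### Approximate kernels -/

/-- `S` approximates the kernel `t ^ (-(1 + α))` up to `ε` on `[h, ℓ]`. -/
theorem abs_integral_kernel_sub_le {α h ℓ ε V : ℝ} (hα : 0 < α) (hh : 0 < h) (hhl : h ≤ ℓ)
    {S p : ℝ → ℝ} (hp : Measurable p) (hS : Continuous S)
    (hV : 0 ≤ V) (hε : 0 ≤ ε) (hb : ∀ t, |p t| ≤ V) (hsupp : ∀ t, ℓ < t → p t = 0)
    (hSk : ∀ t ∈ Icc h ℓ, |t ^ (-(1 + α)) - S t| ≤ ε) :
    |(∫ t in Ioi h, p t * t ^ (-(1 + α))) - ∫ t in Ioi h, S t * p t| ≤ V * ε * ℓ := by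
  have hSi : IntegrableOn (fun t => S t * p t) (Ioi h) := by
    rw [← Ioc_union_Ioi_eq_Ioi hhl]
    refine IntegrableOn.union ?_ ?_
    · refine Integrable.mul_bdd (c := V) ?_ hp.aestronglyMeasurable
        (Eventually.of_forall fun t => by simpa using hb t)
      exact (hS.integrableOn_Icc).mono_set Ioc_subset_Icc_self
    · refine integrableOn_zero.congr_fun (fun t ht => ?_) measurableSet_Ioi
      simp [hsupp t ht]
  rw [← integral_sub (integrableOn_bdd_kernel hα hh hp hb) hSi]
  have hz : ∀ t, 0 ≤ (Ioc 0 ℓ).indicator (fun _ : ℝ => V * ε) t := fun t =>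
    indicator_nonneg (fun _ _ => by positivity) t
  have hi : Integrable ((Ioc 0 ℓ).indicator (fun _ : ℝ => V * ε)) :=
    (integrable_indicator_iff measurableSet_Ioc).2 (integrableOn_const (by simp))
  have := norm_integral_le_of_norm_le (f := fun t => p t * t ^ (-(1 + α)) - S t * p t)
    (μ := volume.restrict (Ioi h)) hi.integrableOn
    ((ae_restrict_iff' measurableSet_Ioi).2 (Eventually.of_forall fun t (ht : h < t) => by
      rcases le_or_gt t ℓ with htl | htl
      · rw [indicator_of_mem (show t ∈ Ioc 0 ℓ from ⟨hh.trans ht, htl⟩), Real.norm_eq_abs,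
          show p t * t ^ (-(1 + α)) - S t * p t = p t * (t ^ (-(1 + α)) - S t) by ring, abs_mul]
        exact mul_le_mul (hb t) (hSk t ⟨ht.le, htl⟩) (abs_nonneg _) hV
      · simpa [hsupp t htl] using hz t))
  rw [Real.norm_eq_abs] at this
  refine this.trans ((setIntegral_le_integral hi (Eventually.of_forall hz)).trans (le_of_eq ?_))
  rw [integral_indicator measurableSet_Ioc]
  simp [(hh.trans_le hhl).le]
  ring

/-- On `[h, ℓ]` one has `0 ≤ S ≤ t^(-1-α) + ε`, and `p` vanishes beyond `ℓ`. The term `-ℓ^(-α)` is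
kept because it becomes the stability surplus. -/
theorem abs_integral_le_of_approx {α h ℓ ε V : ℝ} (hα : 0 < α) (hh : 0 < h) (hhl : h ≤ ℓ)
    {S p : ℝ → ℝ} (hV : 0 ≤ V) (hε : 0 ≤ ε) (hb : ∀ t, |p t| ≤ V)
    (hsupp : ∀ t, ℓ < t → p t = 0) (hS0 : ∀ t, 0 ≤ S t)
    (hSk : ∀ t ∈ Icc h ℓ, |t ^ (-(1 + α)) - S t| ≤ ε) :
    |∫ t in Ioi h, S t * p t| ≤ V * ((h ^ (-α) - ℓ ^ (-α)) / α + ε * ℓ) := by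
  have hl : 0 < ℓ := hh.trans_le hhl
  let g : ℝ → ℝ := (Iic ℓ).indicator (fun t => V * (t ^ (-(1 + α)) + ε))
  have hki : IntegrableOn (fun t : ℝ => t ^ (-(1 + α))) (Ioc h ℓ) :=
    (integrableOn_kernel hα hh).mono_set Ioc_subset_Ioi_self
  have hgi : IntegrableOn (fun t : ℝ => V * (t ^ (-(1 + α)) + ε)) (Ioc h ℓ) :=
    (hki.add (integrableOn_const (by simp))).const_mul V
  have hinter : Ioi h ∩ Iic ℓ = Ioc h ℓ := by ext; simp
  have hgint : IntegrableOn g (Ioi h) := by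
    rw [integrableOn_indicator_iff measurableSet_Iic, inter_comm, hinter]; exact hgi
  have := norm_integral_le_of_norm_le (f := fun t => S t * p t)
    (μ := volume.restrict (Ioi h)) hgint
    ((ae_restrict_iff' measurableSet_Ioi).2 (Eventually.of_forall fun t (ht : h < t) => by
      rcases le_or_gt t ℓ with htl | htl
      · simp only [g]
        rw [indicator_of_mem (show t ∈ Iic ℓ from htl), Real.norm_eq_abs, abs_mul,
          abs_of_nonneg (hS0 t), mul_comm]
        have := abs_le.1 (hSk t ⟨ht.le, htl⟩)
        exact mul_le_mul (hb t) (by linarith) (hS0 t) hV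
      · simp [g, hsupp t htl, htl]))
  rw [Real.norm_eq_abs] at this
  refine this.trans ?_
  have hk : ∫ t in Ioc h ℓ, t ^ (-(1 + α)) = (h ^ (-α) - ℓ ^ (-α)) / α := by
    have h1 := setIntegral_union (f := fun t : ℝ => t ^ (-(1 + α))) (Ioc_disjoint_Ioi_same (a := h) (b := ℓ)) measurableSet_Ioi hki
      (integrableOn_kernel hα hl)
    rw [Ioc_union_Ioi_eq_Ioi hhl, integral_kernel hα hh, integral_kernel hα hl] at h1
    rw [sub_div]; linarith
  simp only [g]
  rw [setIntegral_indicator measurableSet_Iic, hinter, integral_const_mul,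
    integral_add hki (integrableOn_const (by simp)), hk]
  refine mul_le_mul_of_nonneg_left (add_le_add_right ?_ _) hV
  simp only [integral_const, measureReal_restrict_apply_univ, Real.volume_real_Ioc_of_le hhl,
    smul_eq_mul]
  nlinarith

end FastCollocation

namespace FastCollocation

/-! ### Piecewise linear interpolation -/

theorem hat_eq_zero_of_le {x : ℕ → ℝ} {j : ℕ} {y : ℝ} (hx : x (j - 1) < x j)
    (h : y ≤ x (j - 1)) : hat x j y = 0 := by
  unfold hat
  rcases h.eq_or_lt with h | h
  · rw [if_pos ⟨h.ge, h.trans_le hx.le⟩, h, sub_self, zero_div]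
  · rw [if_neg (by intro h'; linarith [h'.1]), if_neg (by intro h'; linarith [h'.1])]

theorem hat_eq_zero_of_ge {x : ℕ → ℝ} {j : ℕ} {y : ℝ} (hx : x j < x (j + 1))
    (h : x (j + 1) ≤ y) : hat x j y = 0 := by
  unfold hat
  rw [if_neg (by intro h'; linarith [h'.2])]
  split_ifs with h2
  · simp [le_antisymm h2.2 h]
  · rfl

theorem hat_left {x : ℕ → ℝ} {j : ℕ} {y : ℝ} (h : y ∈ Icc (x (j - 1)) (x j)) :
    hat x j y = (y - x (j - 1)) / (x j - x (j - 1)) := by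
  unfold hat
  rw [if_pos ⟨h.1, h.2⟩]

theorem hat_right {x : ℕ → ℝ} {j : ℕ} {y : ℝ} (hx : x (j - 1) < x j) (hx' : x j < x (j + 1))
    (h : y ∈ Icc (x j) (x (j + 1))) :
    hat x j y = (x (j + 1) - y) / (x (j + 1) - x j) := by
  rcases h.1.eq_or_lt with h1 | h1
  · rw [hat_left ⟨h1 ▸ hx.le, h1.ge⟩, ← h1, div_self (by linarith), div_self (by linarith)]
  · unfold hat
    rw [if_neg (by intro h'; linarith [h'.2]), if_pos ⟨h.1, h.2⟩]

theorem measurable_hat (x : ℕ → ℝ) (j : ℕ) : Measurable (hat x j) := by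
  unfold hat
  refine Measurable.ite (measurableSet_Icc (a := x (j - 1)) (b := x j)) (by fun_prop) ?_
  exact Measurable.ite (measurableSet_Icc (a := x j) (b := x (j + 1))) (by fun_prop)
    measurable_const

theorem measurable_interp (x : ℕ → ℝ) (N : ℕ) (v : ℕ → ℝ) : Measurable (interp x N v) := by
  unfold interp
  exact Finset.measurable_fun_sum _ fun j _ => (measurable_hat x j).const_mul _

theorem interp_add (x : ℕ → ℝ) (N : ℕ) (v w : ℕ → ℝ) (y : ℝ) :
    interp x N (v + w) y = interp x N v y + interp x N w y := by
  simp [interp, add_mul, Finset.sum_add_distrib]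

theorem interp_smul (x : ℕ → ℝ) (N : ℕ) (a : ℝ) (v : ℕ → ℝ) (y : ℝ) :
    interp x N (a • v) y = a * interp x N v y := by
  simp [interp, Finset.mul_sum, mul_assoc]

/-- `x 0 < x 1 < ⋯ < x N` are the nodes of a mesh of `[a, b]`. -/
structure IsMesh (x : ℕ → ℝ) (N : ℕ) (a b : ℝ) : Prop where
  lt_succ : ∀ i < N, x i < x (i + 1)
  zero : x 0 = a
  last : x N = b

namespace IsMesh

variable {x : ℕ → ℝ} {N : ℕ} {a b : ℝ}

theorem le_of_le (hx : IsMesh x N a b) {i j : ℕ} (hij : i ≤ j) (hj : j ≤ N) : x i ≤ x j := by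
  induction j, hij using Nat.le_induction with
  | base => exact le_rfl
  | succ k hk ih => exact (ih (by omega)).trans (hx.lt_succ k (by omega)).le

theorem lt_of_lt (hx : IsMesh x N a b) {i j : ℕ} (hij : i < j) (hj : j ≤ N) : x i < x j :=
  (hx.lt_succ i (by omega)).trans_le (hx.le_of_le hij hj)

theorem pred_lt (hx : IsMesh x N a b) {j : ℕ} (hj : 1 ≤ j) (hjN : j ≤ N) : x (j - 1) < x j :=
  hx.lt_of_lt (by omega) hjN

theorem step_pos (hx : IsMesh x N a b) {j : ℕ} (hj : 1 ≤ j) (hjN : j ≤ N) : 0 < step x j :=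
  sub_pos.2 (hx.pred_lt hj hjN)

theorem exists_cell (hx : IsMesh x N a b) (hN : 0 < N) {y : ℝ} (hy : y ∈ Icc a b) :
    ∃ j, 1 ≤ j ∧ j ≤ N ∧ y ∈ Icc (x (j - 1)) (x j) := by
  classical
  have hex : ∃ j, 1 ≤ j ∧ y ≤ x j := ⟨N, hN, by rw [hx.last]; exact hy.2⟩
  have hs := Nat.find_spec hex
  have hle : Nat.find hex ≤ N := Nat.find_min' hex ⟨hN, by rw [hx.last]; exact hy.2⟩
  refine ⟨Nat.find hex, hs.1, hle, ?_, hs.2⟩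
  by_contra hlt
  rcases Nat.lt_or_ge 1 (Nat.find hex) with h | h
  · exact Nat.find_min hex (m := Nat.find hex - 1) (by omega) ⟨by omega, (not_le.1 hlt).le⟩
  · have : Nat.find hex - 1 = 0 := by omega
    rw [this, hx.zero] at hlt
    exact hlt hy.1

theorem interp_eq_zero (hx : IsMesh x N a b) {y : ℝ} (hy : y ≤ a ∨ b ≤ y) (v : ℕ → ℝ) :
    interp x N v y = 0 := by
  refine Finset.sum_eq_zero fun j hj => ?_
  rw [Finset.mem_Icc] at hj
  rcases hy with hy | hy
  · rw [hat_eq_zero_of_le (hx.pred_lt hj.1 (by omega)), mul_zero]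
    exact hy.trans (hx.zero ▸ hx.le_of_le (Nat.zero_le _) (by omega))
  · rw [hat_eq_zero_of_ge (hx.lt_succ j (by omega)), mul_zero]
    exact le_trans (hx.last ▸ hx.le_of_le (by omega) le_rfl) hy

theorem interp_eq (hx : IsMesh x N a b) {v : ℕ → ℝ} (h0 : v 0 = 0) (hNv : v N = 0)
    {j : ℕ} (hj : 1 ≤ j) (hjN : j ≤ N) {y : ℝ} (hy : y ∈ Icc (x (j - 1)) (x j)) :
    interp x N v y = v (j - 1) + (v j - v (j - 1)) * ((y - x (j - 1)) / step x j) := by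
  have hzero : ∀ k ∈ Finset.Icc 1 (N - 1), k ∉ ({j - 1, j} : Finset ℕ) →
      v k * hat x k y = 0 := by
    intro k hk hkj
    rw [Finset.mem_Icc] at hk
    simp only [Finset.mem_insert, Finset.mem_singleton, not_or] at hkj
    rcases lt_or_ge k j with h | h
    · rw [hat_eq_zero_of_ge (hx.lt_succ k (by omega)), mul_zero]
      exact (hx.le_of_le (by omega) (by omega)).trans hy.1
    · rw [hat_eq_zero_of_le (hx.pred_lt hk.1 (by omega)), mul_zero]
      exact hy.2.trans (hx.le_of_le (by omega) (by omega))
  -- The nodal sum has no terms for `0` and `N`; the zero boundary values allow both to be added.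
  have hzero' : ∀ k ∈ ({j - 1, j} : Finset ℕ), k ∉ Finset.Icc 1 (N - 1) →
      v k * hat x k y = 0 := by
    intro k hk hkj
    rw [Finset.mem_Icc] at hkj
    simp only [Finset.mem_insert, Finset.mem_singleton] at hk
    have : k = 0 ∨ k = N := by omega
    rcases this with rfl | rfl <;> simp [h0, hNv]
  have hsum : interp x N v y = ∑ k ∈ ({j - 1, j} : Finset ℕ), v k * hat x k y := by
    unfold interp
    rw [← Finset.sum_inter_add_sum_sdiff (Finset.Icc 1 (N - 1)) {j - 1, j},
      ← Finset.sum_inter_add_sum_sdiff {j - 1, j} (Finset.Icc 1 (N - 1)), Finset.inter_comm,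
      Finset.sum_eq_zero (s := Finset.Icc 1 (N - 1) \ {j - 1, j}),
      Finset.sum_eq_zero (s := {j - 1, j} \ Finset.Icc 1 (N - 1))]
    · intro k hk; rw [Finset.mem_sdiff] at hk; exact hzero' k hk.1 hk.2
    · intro k hk; rw [Finset.mem_sdiff] at hk; exact hzero k hk.1 hk.2
  have hstep : 0 < x j - x (j - 1) := sub_pos.2 (hx.pred_lt hj hjN)
  rw [hsum, Finset.sum_pair (by omega), hat_left hy]
  have hleft : v (j - 1) * hat x (j - 1) y
      = v (j - 1) * ((x j - y) / (x j - x (j - 1))) := by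
    -- For `j = 1` the function `hat x 0` is not a genuine hat, since `0 - 1 = 0` in `ℕ`, but its
    -- coefficient is zero.
    rcases Nat.eq_zero_or_pos (j - 1) with h | h
    · rw [h, h0, zero_mul, zero_mul]
    · have hjj : j - 1 + 1 = j := by omega
      have := hat_right (x := x) (j := j - 1) (y := y) (hx.pred_lt h (by omega))
        (hx.lt_succ _ (by omega)) (by rwa [hjj])
      rw [this, hjj]
  rw [hleft, step]
  field_simp
  ring

theorem abs_interp_le (hx : IsMesh x N a b) (hN : 0 < N) {v : ℕ → ℝ} (h0 : v 0 = 0)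
    (hNv : v N = 0) {V : ℝ} (hV : ∀ i ≤ N, |v i| ≤ V) (y : ℝ) : |interp x N v y| ≤ V := by
  have hV0 : 0 ≤ V := (abs_nonneg _).trans (hV 0 (Nat.zero_le _))
  by_cases hy : y ∈ Icc a b
  · obtain ⟨j, hj, hjN, hyj⟩ := hx.exists_cell hN hy
    have hs := hx.step_pos hj hjN
    rw [hx.interp_eq h0 hNv hj hjN hyj]
    set s := (y - x (j - 1)) / step x j
    have hs0 : 0 ≤ s := div_nonneg (sub_nonneg.2 hyj.1) hs.le
    have hs1 : s ≤ 1 := (div_le_one hs).2 (by unfold step; linarith [hyj.2])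
    have h1 := abs_le.1 (hV (j - 1) (by omega))
    have h2 := abs_le.1 (hV j hjN)
    rw [abs_le]
    constructor <;> nlinarith
  · rw [hx.interp_eq_zero, abs_zero]
    · exact hV0
    · simp only [mem_Icc, not_and_or, not_le] at hy
      exact hy.imp le_of_lt le_of_lt

end IsMesh

/-! ### The discrete operator as a sum of two one-sided operators -/

/-- The sum of exponentials `∑ θ_s e^{-lam_s t}`. -/
noncomputable def expSum {Ne : ℕ} (lam θ : Fin Ne → ℝ) (t : ℝ) : ℝ :=
  ∑ s, θ s * Real.exp (-(lam s) * t)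

/-- One-sided part of the collocation operator, with kernel `S` in the far field and
profile `p`. -/
noncomputable def sideOp (α h v₀ v₁ : ℝ) (S p : ℝ → ℝ) : ℝ :=
  (v₀ - v₁) * h ^ (-α) / (1 - α) + v₀ * h ^ (-α) / α - ∫ t in Ioi h, S t * p t

theorem continuous_expSum {Ne : ℕ} (lam θ : Fin Ne → ℝ) : Continuous (expSum lam θ) := by
  unfold expSum; fun_prop

theorem IsMesh.integrable_exp_mul_interp {x : ℕ → ℝ} {N : ℕ} {a b : ℝ} (hx : IsMesh x N a b)
    (g : ℝ → ℝ) (hg : Continuous g) (v : ℕ → ℝ) :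
    Integrable (fun y => g y * interp x N v y) := by
  unfold interp
  simp_rw [Finset.mul_sum]
  refine integrable_finsetSum _ fun j hj => ?_
  rw [Finset.mem_Icc] at hj
  have h1 := hx.pred_lt hj.1 (by omega)
  have h2 := hx.lt_succ j (by omega)
  have hb : ∀ y, ‖hat x j y‖ ≤ 1 := by
    intro y
    unfold hat
    split_ifs with c1 c2
    · rw [Real.norm_eq_abs, abs_of_nonneg (div_nonneg (by linarith) (by linarith)),
        div_le_one (by linarith)]
      linarith
    · rw [Real.norm_eq_abs, abs_of_nonneg (div_nonneg (by linarith) (by linarith)),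
        div_le_one (by linarith)]
      linarith
    · simp
  have hon : IntegrableOn (fun y => g y * hat x j y) (Icc (x (j - 1)) (x (j + 1))) :=
    Integrable.mul_bdd (c := 1) hg.integrableOn_Icc (measurable_hat x j).aestronglyMeasurable
      (Eventually.of_forall hb)
  have := (integrableOn_iff_integrable_of_support_subset (μ := volume) ?_).1 hon
  · simpa [mul_left_comm] using this.const_mul (v j)
  · intro y hy
    by_contra hy'
    refine hy ?_
    simp only [mem_Icc, not_and_or, not_le] at hy'
    rcases hy' with h | h
    · simp [hat_eq_zero_of_le h1 h.le]
    · simp [hat_eq_zero_of_ge h2 h.le]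

/-- Reflection and translation move the node to the origin. The diagonal coefficient splits by
`1/(α(1-α)) = 1/(1-α) + 1/α`: the first part comes from the linear profile on the adjacent cell, the
second from the mass of the kernel beyond it. -/
theorem IsMesh.fastOp_eq {x : ℕ → ℝ} {N : ℕ} {a b : ℝ} (hx : IsMesh x N a b) {α : ℝ}
    (hα : 0 < α) (hα1 : α < 1) {Ne : ℕ} (lam θ : Fin Ne → ℝ) (v : ℕ → ℝ) (i : ℕ) :
    fastOp α x N lam θ v i = normConst α *
      (sideOp α (step x i) (v i) (v (i - 1)) (expSum lam θ) (fun t => interp x N v (x i - t))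
        + sideOp α (step x (i + 1)) (v i) (v (i + 1)) (expSum lam θ)
          (fun t => interp x N v (x i + t))) := by
  have hL : ∑ s, θ s * histL x N (lam s) v i
      = ∫ t in Ioi (step x i), expSum lam θ t * interp x N v (x i - t) := by
    have h1 : ∀ l, histL x N l v i
        = ∫ t in Ioi (step x i), Real.exp (-l * t) * interp x N v (x i - t) := by
      intro l
      have := (Measure.measurePreserving_sub_left volume (x i)).setIntegral_preimage_emb
        (MeasurableEquiv.subLeft (x i)).measurableEmbedding
        (fun y => Real.exp (-l * (x i - y)) * interp x N v y) (Iic (x (i - 1)))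
      rw [histL, ← this, ← integral_Ici_eq_integral_Ioi]
      simp only [sub_sub_cancel]
      congr 2
      ext t
      simp only [mem_preimage, mem_Iic, mem_Ici, step]
      constructor <;> intro h <;> linarith
    simp_rw [h1, expSum, Finset.sum_mul, mul_assoc]
    rw [integral_finsetSum]
    · simp_rw [integral_const_mul]
    · intro s _
      have := (hx.integrable_exp_mul_interp (fun y => Real.exp (-lam s * (x i - y)))
        (by fun_prop) v).comp_sub_left (x i)
      simp only [sub_sub_cancel] at this
      exact (this.const_mul _).integrableOn
  have hR : ∑ s, θ s * histR x N (lam s) v i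
      = ∫ t in Ioi (step x (i + 1)), expSum lam θ t * interp x N v (x i + t) := by
    have h1 : ∀ l, histR x N l v i
        = ∫ t in Ioi (step x (i + 1)), Real.exp (-l * t) * interp x N v (x i + t) := by
      intro l
      have := (measurePreserving_add_left volume (x i)).setIntegral_preimage_emb
        (MeasurableEquiv.addLeft (x i)).measurableEmbedding
        (fun y => Real.exp (-l * (y - x i)) * interp x N v y) (Ici (x (i + 1)))
      rw [histR, ← this, ← integral_Ici_eq_integral_Ioi]
      simp only [add_sub_cancel_left]
      congr 2
      ext t
      simp only [mem_preimage, mem_Ici, step, Nat.add_sub_cancel]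
      constructor <;> intro h <;> linarith
    simp_rw [h1, expSum, Finset.sum_mul, mul_assoc]
    rw [integral_finsetSum]
    · simp_rw [integral_const_mul]
    · intro s _
      have := (hx.integrable_exp_mul_interp (fun y => Real.exp (-lam s * (y - x i)))
        (by fun_prop) v).comp_add_left (x i)
      simp only [add_sub_cancel_left] at this
      exact (this.const_mul _).integrableOn
  rw [fastOp, hL, hR, sideOp, sideOp]
  have : 1 - α ≠ 0 := by linarith
  field_simp
  ring

theorem IsMesh.fastOp_add {x : ℕ → ℝ} {N : ℕ} {a b : ℝ} (hx : IsMesh x N a b) (α : ℝ)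
    {Ne : ℕ} (lam θ : Fin Ne → ℝ) (v w : ℕ → ℝ) (i : ℕ) :
    fastOp α x N lam θ (v + w) i = fastOp α x N lam θ v i + fastOp α x N lam θ w i := by
  have hL : ∀ l, histL x N l (v + w) i = histL x N l v i + histL x N l w i := by
    intro l
    simp only [histL, interp_add, mul_add]
    exact integral_add (hx.integrable_exp_mul_interp _ (by fun_prop) v).integrableOn
      (hx.integrable_exp_mul_interp _ (by fun_prop) w).integrableOn
  have hR : ∀ l, histR x N l (v + w) i = histR x N l v i + histR x N l w i := by
    intro l
    simp only [histR, interp_add, mul_add]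
    exact integral_add (hx.integrable_exp_mul_interp _ (by fun_prop) v).integrableOn
      (hx.integrable_exp_mul_interp _ (by fun_prop) w).integrableOn
  simp only [fastOp, hL, hR, mul_add, Finset.sum_add_distrib, Pi.add_apply]
  ring

theorem fastOp_smul (α : ℝ) (x : ℕ → ℝ) (N : ℕ) {Ne : ℕ} (lam θ : Fin Ne → ℝ) (c : ℝ)
    (v : ℕ → ℝ) (i : ℕ) :
    fastOp α x N lam θ (c • v) i = c * fastOp α x N lam θ v i := by
  have hL : ∀ l, histL x N l (c • v) i = c * histL x N l v i := by
    intro l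
    simp only [histL, interp_smul, mul_left_comm _ c, integral_const_mul]
  have hR : ∀ l, histR x N l (c • v) i = c * histR x N l v i := by
    intro l
    simp only [histR, interp_smul, mul_left_comm _ c, integral_const_mul]
  simp only [fastOp, hL, hR, mul_left_comm _ c, ← Finset.mul_sum, Pi.smul_apply, smul_eq_mul]
  ring

theorem IsMesh.fastOp_sub {x : ℕ → ℝ} {N : ℕ} {a b : ℝ} (hx : IsMesh x N a b) (α : ℝ)
    {Ne : ℕ} (lam θ : Fin Ne → ℝ) (v w : ℕ → ℝ) (i : ℕ) :
    fastOp α x N lam θ (v - w) i = fastOp α x N lam θ v i - fastOp α x N lam θ w i := by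
  rw [show v - w = v + (-1 : ℝ) • w by ext; simp [sub_eq_add_neg], hx.fastOp_add, fastOp_smul]
  ring

theorem normConst_pos {α : ℝ} (hα : 0 < α) (hα1 : α < 1) : 0 < normConst α := by
  unfold normConst
  have h1 := Real.Gamma_pos_of_pos (show 0 < (1 + α) / 2 by linarith)
  have h2 := Real.Gamma_pos_of_pos (show 0 < 1 - α / 2 by linarith)
  positivity

end FastCollocation

namespace FastCollocation

/-! ### Stability and unique solvability of the scheme -/

theorem IsSOE.expSum_nonneg {β ε Δx X : ℝ} {Ne : ℕ} {lam θ : Fin Ne → ℝ}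
    (h : IsSOE β ε Δx X Ne lam θ) (t : ℝ) : 0 ≤ expSum lam θ t :=
  Finset.sum_nonneg fun s _ => mul_nonneg (h.weight_pos s).le (Real.exp_pos _).le

/-- At a maximum the difference term has a sign, and `h^(-α)/α` is the full kernel mass beyond `h`.
The far-field integral uses up only the mass on `[h, ℓ]`, up to `ε ℓ`. -/
theorem sideOp_ge {α h ℓ ε v₀ v₁ : ℝ} (hα : 0 < α) (hα1 : α < 1) (hh : 0 < h) (hhl : h ≤ ℓ)
    {S p : ℝ → ℝ} (hε : 0 ≤ ε) (h1 : |v₁| ≤ v₀) (hb : ∀ t, |p t| ≤ v₀)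
    (hsupp : ∀ t, ℓ < t → p t = 0) (hS0 : ∀ t, 0 ≤ S t)
    (hSk : ∀ t ∈ Icc h ℓ, |t ^ (-(1 + α)) - S t| ≤ ε) :
    v₀ * (ℓ ^ (-α) / α - ε * ℓ) ≤ sideOp α h v₀ v₁ S p := by
  have h3 := abs_integral_le_of_approx hα hh hhl ((abs_nonneg _).trans h1) hε hb hsupp hS0 hSk
  have h2 : 0 ≤ (v₀ - v₁) * h ^ (-α) / (1 - α) := by
    have := abs_le.1 h1
    have h3 : 0 ≤ v₀ - v₁ := by linarith
    have h4 : 0 < 1 - α := by linarith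
    positivity
  have h4 := (abs_le.1 h3).2
  unfold sideOp
  calc v₀ * (ℓ ^ (-α) / α - ε * ℓ)
      = v₀ * h ^ (-α) / α - v₀ * ((h ^ (-α) - ℓ ^ (-α)) / α + ε * ℓ) := by ring
    _ ≤ _ := by linarith

/-- The lower bound of the row sums of the scheme. -/
noncomputable def rowWeight (α L y : ℝ) : ℝ :=
  normConst α / (2 * α) * (y ^ (-α) + (2 * L - y) ^ (-α))

/-- The largest tolerance for which stability is guaranteed. -/
noncomputable def tolBound (α L : ℝ) : ℝ := (2 * L) ^ (-α) / α / (2 * L)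

theorem tolBound_pos {α L : ℝ} (hα : 0 < α) (hL : 0 < L) : 0 < tolBound α L := by
  unfold tolBound; positivity

theorem two_mul_rpow_le {α L y : ℝ} (hα : 0 < α) (h0 : 0 < y) (h1 : y ≤ 2 * L) :
    (2 * L) ^ (-α) ≤ y ^ (-α) :=
  Real.rpow_le_rpow_of_nonpos h0 h1 (by linarith)

section Scheme

variable {α L ε Δx X : ℝ} {x : ℕ → ℝ} {N Ne : ℕ} {lam θ : Fin Ne → ℝ}

theorem IsMesh.node_mem (hx : IsMesh x N 0 (2 * L)) {m : ℕ} (hm : m ∈ Finset.Icc 1 (N - 1)) :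
    0 < x m ∧ x m < 2 * L := by
  rw [Finset.mem_Icc] at hm
  exact ⟨hx.zero ▸ hx.lt_of_lt (by omega) (by omega),
    hx.last ▸ hx.lt_of_lt (by omega) le_rfl⟩

theorem IsMesh.approx_left (hx : IsMesh x N 0 (2 * L)) (hX : 2 * L ≤ X)
    (hΔ : ∀ j ∈ Finset.Icc 1 N, Δx ≤ step x j) (hS : IsSOE (1 + α) ε Δx X Ne lam θ)
    {m : ℕ} (hm : m ∈ Finset.Icc 1 (N - 1)) :
    ∀ t ∈ Icc (step x m) (x m), |t ^ (-(1 + α)) - expSum lam θ t| ≤ ε := by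
  intro t ht
  have := hx.node_mem hm
  rw [Finset.mem_Icc] at hm
  exact hS.approx t ⟨(hΔ m (Finset.mem_Icc.2 ⟨hm.1, by omega⟩)).trans ht.1, by linarith [ht.2]⟩

theorem IsMesh.approx_right (hx : IsMesh x N 0 (2 * L)) (hX : 2 * L ≤ X)
    (hΔ : ∀ j ∈ Finset.Icc 1 N, Δx ≤ step x j) (hS : IsSOE (1 + α) ε Δx X Ne lam θ)
    {m : ℕ} (hm : m ∈ Finset.Icc 1 (N - 1)) :
    ∀ t ∈ Icc (step x (m + 1)) (2 * L - x m), |t ^ (-(1 + α)) - expSum lam θ t| ≤ ε := by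
  intro t ht
  have := hx.node_mem hm
  rw [Finset.mem_Icc] at hm
  exact hS.approx t
    ⟨(hΔ (m + 1) (Finset.mem_Icc.2 ⟨by omega, by omega⟩)).trans ht.1, by linarith [ht.2]⟩

theorem IsMesh.step_le_left (hx : IsMesh x N 0 (2 * L)) {m : ℕ}
    (hm : m ∈ Finset.Icc 1 (N - 1)) : step x m ≤ x m := by
  rw [Finset.mem_Icc] at hm
  have := hx.le_of_le (Nat.zero_le (m - 1)) (by omega)
  rw [hx.zero] at this
  unfold step; linarith

theorem IsMesh.step_le_right (hx : IsMesh x N 0 (2 * L)) {m : ℕ}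
    (hm : m ∈ Finset.Icc 1 (N - 1)) : step x (m + 1) ≤ 2 * L - x m := by
  rw [Finset.mem_Icc] at hm
  have := hx.le_of_le (show m + 1 ≤ N by omega) le_rfl
  rw [hx.last] at this
  simp only [step, Nat.add_sub_cancel]; linarith

theorem IsMesh.fastOp_ge_of_max (hx : IsMesh x N 0 (2 * L)) (hα : 0 < α) (hα1 : α < 1)
    (hL : 0 < L) (hε : 0 ≤ ε) (hε₀ : ε ≤ tolBound α L) (hX : 2 * L ≤ X)
    (hΔ : ∀ j ∈ Finset.Icc 1 N, Δx ≤ step x j) (hS : IsSOE (1 + α) ε Δx X Ne lam θ)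
    {v : ℕ → ℝ} (h0 : v 0 = 0) (hN : v N = 0) {m : ℕ} (hm : m ∈ Finset.Icc 1 (N - 1))
    (hmax : ∀ i ≤ N, |v i| ≤ v m) :
    v m * rowWeight α L (x m) ≤ fastOp α x N lam θ v m := by
  have hm' := Finset.mem_Icc.1 hm
  obtain ⟨hx0, hx1⟩ := hx.node_mem hm
  have hNpos : 0 < N := by omega
  have hV : 0 ≤ v m := (abs_nonneg _).trans (hmax m (by omega))
  have hb := hx.abs_interp_le hNpos h0 hN hmax
  have hl := sideOp_ge hα hα1 (hx.step_pos hm'.1 (by omega)) (hx.step_le_left hm)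
    (p := fun t => interp x N v (x m - t)) hε (hmax (m - 1) (by omega)) (fun t => hb _)
    (fun t ht => hx.interp_eq_zero (Or.inl (by linarith)) v) hS.expSum_nonneg
    (hx.approx_left hX hΔ hS hm)
  have hr := sideOp_ge hα hα1 (hx.step_pos (j := m + 1) (by omega) (by omega))
    (hx.step_le_right hm)
    (p := fun t => interp x N v (x m + t)) hε (hmax (m + 1) (by omega)) (fun t => hb _)
    (fun t ht => hx.interp_eq_zero (Or.inr (by linarith)) v) hS.expSum_nonneg
    (hx.approx_right hX hΔ hS hm)
  rw [hx.fastOp_eq hα hα1]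
  have hC := normConst_pos hα hα1
  -- Both powers are at least `(2L)^(-α)`, so `tolBound` makes the total tolerance cost `ε x + ε (2L
  -- - x)` at most half of the exterior mass; the other half is `rowWeight`.
  have he : ε * (2 * L) ≤ (x m ^ (-α) + (2 * L - x m) ^ (-α)) / (2 * α) := by
    have h1 : ε * (2 * L) ≤ (2 * L) ^ (-α) / α := by
      have := mul_le_mul_of_nonneg_right hε₀ (show 0 ≤ 2 * L by linarith)
      rwa [tolBound, div_mul_cancel₀ _ (by linarith)] at this
    refine h1.trans ?_
    rw [div_le_div_iff₀ hα (by linarith)]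
    have a1 := two_mul_rpow_le hα hx0 hx1.le
    have a2 := two_mul_rpow_le hα (show 0 < 2 * L - x m by linarith)
      (show 2 * L - x m ≤ 2 * L by linarith)
    nlinarith
  calc v m * rowWeight α L (x m)
      = normConst α * (v m * ((x m ^ (-α) + (2 * L - x m) ^ (-α)) / (2 * α))) := by
        unfold rowWeight; ring
    _ ≤ normConst α * (v m * ((x m ^ (-α) + (2 * L - x m) ^ (-α)) / α - ε * (2 * L))) := by
        gcongr
        have : (x m ^ (-α) + (2 * L - x m) ^ (-α)) / α
          = 2 * ((x m ^ (-α) + (2 * L - x m) ^ (-α)) / (2 * α)) := by field_simp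
        linarith
    _ = normConst α * (v m * (x m ^ (-α) / α - ε * x m)
          + v m * ((2 * L - x m) ^ (-α) / α - ε * (2 * L - x m))) := by ring
    _ ≤ _ := by gcongr

theorem rowWeight_pos (hα : 0 < α) (hα1 : α < 1) {y : ℝ} (h0 : 0 < y) (h1 : y < 2 * L) :
    0 < rowWeight α L y := by
  have hC := normConst_pos hα hα1
  have : 0 < 2 * L - y := by linarith
  unfold rowWeight
  positivity

/-- Discrete maximum principle: weighted stability of the scheme in the maximum norm. -/
theorem IsMesh.stability (hx : IsMesh x N 0 (2 * L)) (hα : 0 < α) (hα1 : α < 1)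
    (hL : 0 < L) (hε : 0 ≤ ε) (hε₀ : ε ≤ tolBound α L) (hX : 2 * L ≤ X)
    (hΔ : ∀ j ∈ Finset.Icc 1 N, Δx ≤ step x j) (hS : IsSOE (1 + α) ε Δx X Ne lam θ)
    {v : ℕ → ℝ} (h0 : v 0 = 0) (hN : v N = 0) {B : ℝ} (hB : 0 ≤ B)
    (hv : ∀ m ∈ Finset.Icc 1 (N - 1),
      |fastOp α x N lam θ v m| ≤ B * rowWeight α L (x m)) :
    ∀ i ≤ N, |v i| ≤ B := by
  obtain ⟨m, hm, hmax⟩ := Finset.exists_max_image (Finset.range (N + 1)) (fun i => |v i|)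
    ⟨0, by simp⟩
  have hmax' : ∀ i ≤ N, |v i| ≤ |v m| := fun i hi => hmax i (by simp; omega)
  suffices |v m| ≤ B from fun i hi => (hmax' i hi).trans this
  rw [Finset.mem_range] at hm
  by_cases hm0 : m ∈ Finset.Icc 1 (N - 1)
  · have hw := rowWeight_pos hα hα1 (hx.node_mem hm0).1 (hx.node_mem hm0).2
    -- Linearity reduces a negative extremum to a positive maximum.
    have hkey : |v m| * rowWeight α L (x m) ≤ |fastOp α x N lam θ v m| := by
      rcases le_total 0 (v m) with hs | hs
      · rw [abs_of_nonneg hs] at hmax' ⊢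
        exact (hx.fastOp_ge_of_max hα hα1 hL hε hε₀ hX hΔ hS h0 hN hm0 hmax').trans (le_abs_self _)
      · rw [abs_of_nonpos hs] at hmax' ⊢
        have := hx.fastOp_ge_of_max hα hα1 hL hε hε₀ hX hΔ hS (v := (-1 : ℝ) • v)
          (by simp [h0]) (by simp [hN]) hm0 (by simpa using hmax')
        rw [fastOp_smul] at this
        have h2 := neg_le_abs (fastOp α x N lam θ v m)
        simp only [Pi.smul_apply, smul_eq_mul, neg_one_mul] at this
        linarith
    exact le_of_mul_le_mul_right (hkey.trans (hv m hm0)) hw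
  · have : m = 0 ∨ m = N := by
      rw [Finset.mem_Icc] at hm0; omega
    rcases this with rfl | rfl <;> simpa [h0, hN] using hB

/-- A vector of interior values, extended by `0`. -/
noncomputable def extend (N : ℕ) (w : Fin (N - 1) → ℝ) (i : ℕ) : ℝ :=
  if h : 1 ≤ i ∧ i ≤ N - 1 then w ⟨i - 1, by omega⟩ else 0

/-- Stability with `B = 0` makes the square linear system on the interior values injective, hence
surjective. -/
theorem IsMesh.exists_solution (hx : IsMesh x N 0 (2 * L)) (hα : 0 < α) (hα1 : α < 1)
    (hL : 0 < L) (hε : 0 ≤ ε) (hε₀ : ε ≤ tolBound α L) (hX : 2 * L ≤ X)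
    (hΔ : ∀ j ∈ Finset.Icc 1 N, Δx ≤ step x j) (hS : IsSOE (1 + α) ε Δx X Ne lam θ)
    (f : ℝ → ℝ) : ∃ U, IsFastSolution α x N lam θ f U := by
  have hadd : ∀ w w', extend N (w + w') = extend N w + extend N w' := by
    intro w w'; ext i; simp only [extend, Pi.add_apply]; split_ifs <;> simp
  have hsmul : ∀ (c : ℝ) w, extend N (c • w) = c • extend N w := by
    intro c w; ext i; simp only [extend, Pi.smul_apply]; split_ifs <;> simp
  have hz0 : ∀ w, extend N w 0 = 0 := by
    intro w; unfold extend; rw [dif_neg (by omega)]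
  have hzN : ∀ w, extend N w N = 0 := by
    intro w; unfold extend; rw [dif_neg (by omega)]
  let T : (Fin (N - 1) → ℝ) →ₗ[ℝ] (Fin (N - 1) → ℝ) :=
    { toFun := fun w k => fastOp α x N lam θ (extend N w) (k + 1)
      map_add' := by
        intro w w'; ext k; simp only [hadd, hx.fastOp_add, Pi.add_apply]
      map_smul' := by
        intro c w; ext k
        simp only [hsmul, fastOp_smul, Pi.smul_apply, smul_eq_mul, RingHom.id_apply] }
  have hT : ∀ w k, T w k = fastOp α x N lam θ (extend N w) (k + 1) := fun _ _ => rfl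
  have hinj : Function.Injective T := by
    rw [← LinearMap.ker_eq_bot, LinearMap.ker_eq_bot']
    intro w hw
    have hst := hx.stability hα hα1 hL hε hε₀ hX hΔ hS (hz0 w) (hzN w) le_rfl (fun m hm => by
      rw [Finset.mem_Icc] at hm
      have := congrFun hw ⟨m - 1, by omega⟩
      rw [hT] at this
      simp only [Nat.sub_add_cancel hm.1, Pi.zero_apply] at this
      rw [this]; simp)
    ext k
    have := hst (k + 1) (by omega)
    unfold extend at this
    rw [dif_pos (by omega)] at this
    simpa using this
  obtain ⟨w, hw⟩ := (LinearMap.injective_iff_surjective.1 hinj) fun k => f (x (k + 1))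
  refine ⟨extend N w, fun i hi => ?_, hz0 w, hzN w⟩
  rw [Finset.mem_Icc] at hi
  have := congrFun hw ⟨i - 1, by omega⟩
  rw [hT] at this
  simpa only [Nat.sub_add_cancel hi.1] using this

theorem IsMesh.abs_sub_le_of_solution (hx : IsMesh x N 0 (2 * L)) (hα : 0 < α) (hα1 : α < 1)
    (hL : 0 < L) (hε : 0 ≤ ε) (hε₀ : ε ≤ tolBound α L) (hX : 2 * L ≤ X)
    (hΔ : ∀ j ∈ Finset.Icc 1 N, Δx ≤ step x j) (hS : IsSOE (1 + α) ε Δx X Ne lam θ)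
    {f : ℝ → ℝ} {U v : ℕ → ℝ} (hU : IsFastSolution α x N lam θ f U)
    (h0 : v 0 = 0) (hN : v N = 0) {B : ℝ} (hB : 0 ≤ B)
    (hv : ∀ m ∈ Finset.Icc 1 (N - 1),
      |fastOp α x N lam θ v m - f (x m)| ≤ B * rowWeight α L (x m)) :
    ∀ i ≤ N, |v i - U i| ≤ B := by
  refine hx.stability (v := v - U) hα hα1 hL hε hε₀ hX hΔ hS (by simp [h0, hU.left])
    (by simp [hN, hU.right]) hB fun m hm => ?_
  rw [hx.fastOp_sub, hU.eqn m hm]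
  exact hv m hm

end Scheme

end FastCollocation

namespace FastCollocation

/-! ### Truncation error -/

/-- The truncated one-sided integral of `u` against the kernel differs from the exact one-sided
operator of its linear interpolant `p` by the interpolation error and a vanishing term. -/
theorem abs_integral_sub_sideOp_le {α δ h v₀ v₁ V E : ℝ} (hα : 0 < α) (hα1 : α < 1) (hδ : 0 < δ)
    (hδh : δ < h) {p u : ℝ → ℝ} (hp : Measurable p) (hb : ∀ t, |p t| ≤ V)
    (hlin : ∀ t ∈ Icc 0 h, p t = v₀ + (v₁ - v₀) * (t / h))
    (hu : IntegrableOn (fun t => (v₀ - u t) * t ^ (-(1 + α))) (Ioi δ))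
    (hE : |∫ t in Ioi δ, (u t - p t) * t ^ (-(1 + α))| ≤ E) :
    |(∫ t in Ioi δ, (v₀ - u t) * t ^ (-(1 + α)))
      - (sideOp α h v₀ v₁ (fun t => t ^ (-(1 + α))) p
        - (v₀ - v₁) / h * (δ ^ (1 - α) / (1 - α)))| ≤ E := by
  have hh : 0 < h := hδ.trans hδh
  have hpint : IntegrableOn (fun t => (v₀ - p t) * t ^ (-(1 + α))) (Ioi δ) := by
    refine integrableOn_bdd_kernel (V := |v₀| + V) hα hδ (measurable_const.sub hp) fun t => ?_
    exact (abs_sub _ _).trans (by gcongr; exact hb t)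
  have hprof : sideOp α h v₀ v₁ (fun t => t ^ (-(1 + α))) p
      - (v₀ - v₁) / h * (δ ^ (1 - α) / (1 - α))
      = ∫ t in Ioi δ, (v₀ - p t) * t ^ (-(1 + α)) := by
    rw [integral_profile hα hα1 hδ hδh hp hb hlin, sideOp]
    simp_rw [mul_comm (p _)]
    rw [show h ^ (1 - α) = h ^ (-α) * h by rw [← Real.rpow_add_one hh.ne']; congr 1; ring]
    have : 1 - α ≠ 0 := by linarith
    field_simp
    ring
  rw [hprof, ← integral_sub hu hpint]
  rw [← abs_neg, ← integral_neg]
  convert hE using 3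
  ext t
  ring

/-- Two comparisons: the limit of the truncated integrals of `u` against the exact-kernel operator
on its interpolant, then the exact kernel against the exponential sum. The latter costs `V ε` times
the distance to each boundary point, in total `V ε * (2L)`. -/
theorem IsMesh.truncation_error {α L ε Δx X : ℝ} {x : ℕ → ℝ} {N Ne : ℕ} {lam θ : Fin Ne → ℝ}
    (hx : IsMesh x N 0 (2 * L)) (hα : 0 < α) (hα1 : α < 1)
    (hε : 0 ≤ ε) (hX : 2 * L ≤ X)
    (hΔ : ∀ j ∈ Finset.Icc 1 N, Δx ≤ step x j) (hS : IsSOE (1 + α) ε Δx X Ne lam θ)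
    {u : ℝ → ℝ} {V f A B r d : ℝ} (hu0 : u 0 = 0) (huL : u (2 * L) = 0) (hV : ∀ y, |u y| ≤ V)
    {m : ℕ} (hm : m ∈ Finset.Icc 1 (N - 1)) (hf : HasFracLaplacianAt α u (x m) f)
    (hA : 0 ≤ A) (hB : 0 ≤ B) (hr : 0 < r) (hd : 0 < d)
    (he : ∀ y, |u y - interp x N (fun i => u (x i)) y|
      ≤ A * min 1 (|y - x m| / r) + B * (if d ≤ |y - x m| then 1 else 0)) :
    |fastOp α x N lam θ (fun i => u (x i)) m - f|
      ≤ normConst α * (2 * (A * (r ^ (-α) * (1 / (1 - α) + 1 / α)) + B * (d ^ (-α) / α))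
        + V * ε * (2 * L)) := by
  have hm' := Finset.mem_Icc.1 hm
  have hV0 : 0 ≤ V := (abs_nonneg _).trans (hV 0)
  have hC := normConst_pos hα hα1
  have h0 : u (x 0) = 0 := by rw [hx.zero, hu0]
  have hN : u (x N) = 0 := by rw [hx.last, huL]
  set v : ℕ → ℝ := fun i => u (x i) with hv
  set k : ℝ → ℝ := fun t => t ^ (-(1 + α)) with hk
  set pl : ℝ → ℝ := fun t => interp x N v (x m - t) with hpl
  set pr : ℝ → ℝ := fun t => interp x N v (x m + t) with hpr
  set hl := step x m with hhl
  set hr' := step x (m + 1) with hhr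
  have hl0 : 0 < hl := hx.step_pos hm'.1 (by omega)
  have hr0 : 0 < hr' := hx.step_pos (by omega) (by omega)
  have mpl : Measurable pl := (measurable_interp x N v).comp (by fun_prop)
  have mpr : Measurable pr := (measurable_interp x N v).comp (by fun_prop)
  have hb := hx.abs_interp_le (v := v) (by omega) h0 hN (V := V) fun i _ => hV _
  have linl : ∀ t ∈ Icc 0 hl, pl t = v m + (v (m - 1) - v m) * (t / hl) := by
    intro t ht
    have : x m - t ∈ Icc (x (m - 1)) (x m) := by
      have := ht.2; have := ht.1
      simp only [hhl, step] at *; constructor <;> linarith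
    simp only [hpl]
    rw [hx.interp_eq h0 hN hm'.1 (by omega) this]
    have e : x m - t - x (m - 1) = hl - t := by simp only [hhl, step]; ring
    rw [e, ← hhl, sub_div, div_self hl0.ne']
    ring
  have linr : ∀ t ∈ Icc 0 hr', pr t = v m + (v (m + 1) - v m) * (t / hr') := by
    intro t ht
    have : x m + t ∈ Icc (x (m + 1 - 1)) (x (m + 1)) := by
      have := ht.2; have := ht.1
      simp only [hhr, step, Nat.add_sub_cancel] at *; constructor <;> linarith
    simp only [hpr]
    rw [hx.interp_eq h0 hN (by omega) (by omega) this]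
    simp only [Nat.add_sub_cancel, add_sub_cancel_left, ← hhr]
  set E := A * (r ^ (-α) * (1 / (1 - α) + 1 / α)) + B * (d ^ (-α) / α) with hEdef
  set Gl := sideOp α hl (v m) (v (m - 1)) k pl with hGl
  set Gr := sideOp α hr' (v m) (v (m + 1)) k pr with hGr
  -- The contribution of the interpolant within distance `δ`. Its slopes on the two sides need not
  -- cancel, but `δ^(1-α) → 0` because `α < 1`.
  set corr : ℝ → ℝ := fun δ => ((v m - v (m - 1)) / hl + (v m - v (m + 1)) / hr')
    * (δ ^ (1 - α) / (1 - α)) with hcorr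
  have htrunc : ∀ δ, 0 < δ → δ < min hl hr' →
      |normConst α * (∫ y in {y : ℝ | δ < |x m - y|}, (u (x m) - u y) / |x m - y| ^ (1 + α))
        - normConst α * (Gl + Gr - corr δ)| ≤ normConst α * (2 * E) := by
    intro δ hδ hδh
    have hint := hf.1 δ hδ
    obtain ⟨il, ir⟩ := integrableOn_outside hint
    have cl : EqOn (fun t => (u (x m) - u (x m - t)) / |x m - (x m - t)| ^ (1 + α))
        (fun t => (v m - u (x m - t)) * t ^ (-(1 + α))) (Ioi δ) := by
      intro t ht
      have ht0 : 0 < t := hδ.trans ht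
      simp only [hv, sub_sub_cancel]
      rw [abs_of_pos ht0, Real.rpow_neg ht0.le, div_eq_mul_inv]
    have cr : EqOn (fun t => (u (x m) - u (x m + t)) / |x m - (x m + t)| ^ (1 + α))
        (fun t => (v m - u (x m + t)) * t ^ (-(1 + α))) (Ioi δ) := by
      intro t ht
      have ht0 : 0 < t := hδ.trans ht
      simp only [hv]
      rw [show x m - (x m + t) = -t by ring, abs_neg, abs_of_pos ht0, Real.rpow_neg ht0.le,
        div_eq_mul_inv]
    rw [integral_outside hδ hint, setIntegral_congr_fun measurableSet_Ioi cl,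
      setIntegral_congr_fun measurableSet_Ioi cr]
    have il' := il.congr_fun cl measurableSet_Ioi
    have ir' := ir.congr_fun cr measurableSet_Ioi
    have El : |∫ t in Ioi δ, (u (x m - t) - pl t) * t ^ (-(1 + α))| ≤ E := by
      refine abs_integral_le_of_profile hα hα1 hδ hr hd hA hB fun t ht => ?_
      have := he (x m - t)
      rwa [show x m - t - x m = -t by ring, abs_neg, abs_of_pos ht] at this
    have Er : |∫ t in Ioi δ, (u (x m + t) - pr t) * t ^ (-(1 + α))| ≤ E := by
      refine abs_integral_le_of_profile hα hα1 hδ hr hd hA hB fun t ht => ?_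
      have := he (x m + t)
      rwa [add_sub_cancel_left, abs_of_pos ht] at this
    have b1 := abs_integral_sub_sideOp_le hα hα1 hδ (hδh.trans_le (min_le_left _ _)) mpl
      (fun t => hb _) linl il' El
    have b2 := abs_integral_sub_sideOp_le hα hα1 hδ (hδh.trans_le (min_le_right _ _)) mpr
      (fun t => hb _) linr ir' Er
    rw [← mul_sub, abs_mul, abs_of_pos hC]
    refine mul_le_mul_of_nonneg_left ?_ hC.le
    have b3 := (abs_add_le _ _).trans (add_le_add b1 b2)
    rw [two_mul]
    refine le_of_eq_of_le (congrArg _ ?_) b3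
    simp only [hcorr]
    ring
  have hcorr0 : Tendsto corr (𝓝[>] 0) (𝓝 0) := by
    have h1 : Tendsto (fun δ : ℝ => δ ^ (1 - α)) (𝓝[>] 0) (𝓝 0) := by
      have := (Real.continuousAt_rpow_const 0 (1 - α) (Or.inr (by linarith))).tendsto
      rw [Real.zero_rpow (by linarith)] at this
      exact this.mono_left nhdsWithin_le_nhds
    have := (h1.div_const (1 - α)).const_mul ((v m - v (m - 1)) / hl + (v m - v (m + 1)) / hr')
    simpa using this
  have hlim : |f - normConst α * (Gl + Gr)| ≤ normConst α * (2 * E) := by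
    have t1 : Tendsto (fun δ => |normConst α *
        (∫ y in {y : ℝ | δ < |x m - y|}, (u (x m) - u y) / |x m - y| ^ (1 + α))
        - normConst α * (Gl + Gr - corr δ)|) (𝓝[>] 0)
        (𝓝 |f - normConst α * (Gl + Gr - 0)|) :=
      (hf.2.sub ((tendsto_const_nhds.sub hcorr0).const_mul _)).abs
    rw [sub_zero] at t1
    refine le_of_tendsto t1 ?_
    have : Ioo 0 (min hl hr') ∈ 𝓝[>] (0 : ℝ) := Ioo_mem_nhdsGT (lt_min hl0 hr0)
    filter_upwards [this] with δ hδ using htrunc δ hδ.1 hδ.2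
  have sl := abs_integral_kernel_sub_le hα hl0 (hx.step_le_left hm) mpl
    (continuous_expSum lam θ) hV0 hε (fun t => hb _)
    (fun t ht => hx.interp_eq_zero (Or.inl (by linarith)) v) (hx.approx_left hX hΔ hS hm)
  have sr := abs_integral_kernel_sub_le hα hr0 (hx.step_le_right hm) mpr
    (continuous_expSum lam θ) hV0 hε (fun t => hb _)
    (fun t ht => hx.interp_eq_zero (Or.inr (by linarith)) v) (hx.approx_right hX hΔ hS hm)
  have hsoe : |fastOp α x N lam θ v m - normConst α * (Gl + Gr)|
      ≤ normConst α * (V * ε * (2 * L)) := by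
    rw [hx.fastOp_eq hα hα1, ← mul_sub, abs_mul, abs_of_pos hC]
    refine mul_le_mul_of_nonneg_left ?_ hC.le
    have b3 := (abs_add_le _ _).trans (add_le_add sl sr)
    rw [show V * ε * (2 * L) = V * ε * x m + V * ε * (2 * L - x m) by ring]
    refine le_of_eq_of_le (congrArg _ ?_) b3
    simp only [hGl, hGr, sideOp, hk]
    simp_rw [mul_comm (pl _), mul_comm (pr _)]
    ring
  have := (abs_sub_le (fastOp α x N lam θ v m) (normConst α * (Gl + Gr)) f).trans
    (add_le_add hsoe ((abs_sub_comm _ _).trans_le hlim))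
  linarith

end FastCollocation

namespace FastCollocation

/-! ### The graded grid -/

/-- Distance to the boundary of the node with distance index `n` in the grid with `2 * M` cells. -/
noncomputable def nodeDist (L κ : ℝ) (M n : ℕ) : ℝ := L * ((n : ℝ) / M) ^ κ

/-- Distance index of the `j`-th cell of the grid with `2 * M` cells. -/
def cellIndex (M j : ℕ) : ℕ := min j (2 * M + 1 - j)

section Grid

variable {L κ : ℝ} {M : ℕ}

theorem nodeDist_zero (hκ : 1 ≤ κ) : nodeDist L κ M 0 = 0 := by
  simp [nodeDist, Real.zero_rpow (show κ ≠ 0 by linarith)]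

theorem nodeDist_self (hM : 0 < M) : nodeDist L κ M M = L := by
  have : (M : ℝ) ≠ 0 := by positivity
  simp [nodeDist, div_self this]

theorem nodeDist_pos (hL : 0 < L) (hM : 0 < M) {n : ℕ} (hn : 0 < n) : 0 < nodeDist L κ M n := by
  unfold nodeDist; positivity

theorem nodeDist_lt (hL : 0 < L) (hκ : 1 ≤ κ) (hM : 0 < M) {m n : ℕ} (h : m < n) :
    nodeDist L κ M m < nodeDist L κ M n := by
  unfold nodeDist
  have : (m : ℝ) / M < n / M := by gcongr
  have hκ0 : 0 < κ := by linarith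
  gcongr

theorem nodeDist_mono (hL : 0 < L) (hκ : 1 ≤ κ) (hM : 0 < M) {m n : ℕ} (h : m ≤ n) :
    nodeDist L κ M m ≤ nodeDist L κ M n := by
  rcases h.eq_or_lt with rfl | h
  · rfl
  · exact (nodeDist_lt hL hκ hM h).le

theorem nodeDist_le (hL : 0 < L) (hκ : 1 ≤ κ) (hM : 0 < M) {n : ℕ} (h : n ≤ M) :
    nodeDist L κ M n ≤ L :=
  (nodeDist_mono hL hκ hM h).trans_eq (nodeDist_self hM)

theorem nodeDist_eq_mul {m n : ℕ} (hM : 0 < M) (hm : 0 < m) :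
    nodeDist L κ M n = nodeDist L κ M m * ((n : ℝ) / m) ^ κ := by
  unfold nodeDist
  rw [mul_assoc, ← Real.mul_rpow (by positivity) (by positivity)]
  congr 2
  field_simp

/-- Here `X_(n-1) = X_n q^κ` with `q = 1 - 1/n`, and `q^κ ≤ q`. With the Bernoulli bound in
`nodeDist_sub_le`, this makes the step comparable to `X_n / n`. -/
theorem div_le_nodeDist_sub (hL : 0 < L) (hκ : 1 ≤ κ) (hM : 0 < M) {n : ℕ} (hn : 1 ≤ n) :
    nodeDist L κ M n / n ≤ nodeDist L κ M n - nodeDist L κ M (n - 1) := by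
  have hn0 : (0 : ℝ) < n := by exact_mod_cast hn
  rw [nodeDist_eq_mul (n := n - 1) hM hn, Nat.cast_sub hn, Nat.cast_one]
  have h1 : (((n : ℝ) - 1) / n) ^ κ ≤ ((n : ℝ) - 1) / n := by
    refine Real.rpow_le_self_of_le_one (div_nonneg ?_ hn0.le) ?_ hκ
    · have : (1 : ℝ) ≤ n := by exact_mod_cast hn
      linarith
    · rw [div_le_one hn0]; linarith
  have hX := nodeDist_pos (κ := κ) hL hM hn
  have := mul_le_mul_of_nonneg_left h1 hX.le
  have e : nodeDist L κ M n * (((n : ℝ) - 1) / n) = nodeDist L κ M n - nodeDist L κ M n / n := by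
    field_simp
  linarith

theorem nodeDist_sub_le (hL : 0 < L) (hκ : 1 ≤ κ) (hM : 0 < M) {n : ℕ} (hn : 1 ≤ n) :
    nodeDist L κ M n - nodeDist L κ M (n - 1) ≤ κ * nodeDist L κ M n / n := by
  have hn0 : (0 : ℝ) < n := by exact_mod_cast hn
  have hn1 : (1 : ℝ) ≤ n := by exact_mod_cast hn
  rw [nodeDist_eq_mul (n := n - 1) hM hn, Nat.cast_sub hn, Nat.cast_one]
  have h1 : 1 + κ * (-(1 / (n : ℝ))) ≤ (((n : ℝ) - 1) / n) ^ κ := by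
    have h := one_add_mul_self_le_rpow_one_add (s := -(1 / (n : ℝ)))
      (by rw [neg_le_neg_iff, div_le_one hn0]; exact hn1) hκ
    rwa [show 1 + -(1 / (n : ℝ)) = ((n : ℝ) - 1) / n by field_simp; ring] at h
  have hX := nodeDist_pos (κ := κ) hL hM hn
  have := mul_le_mul_of_nonneg_left h1 hX.le
  have e : nodeDist L κ M n * (1 + κ * (-(1 / (n : ℝ))))
      = nodeDist L κ M n - κ * nodeDist L κ M n / n := by
    field_simp; ring
  linarith

theorem nodeDist_le_two_rpow_mul (hL : 0 < L) (hκ : 1 ≤ κ) (hM : 0 < M) {n : ℕ} (hn : 2 ≤ n) :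
    nodeDist L κ M n ≤ 2 ^ κ * nodeDist L κ M (n - 1) := by
  have hn1 : (0 : ℝ) < (n - 1 : ℕ) := by exact_mod_cast (show 0 < n - 1 by omega)
  rw [nodeDist_eq_mul (n := n) (m := n - 1) hM (by omega), mul_comm]
  have hX := nodeDist_pos (κ := κ) hL hM (show 0 < n - 1 by omega)
  refine mul_le_mul_of_nonneg_right (Real.rpow_le_rpow (by positivity) ?_ (by linarith)) hX.le
  rw [div_le_iff₀ hn1]
  exact_mod_cast (show n ≤ 2 * (n - 1) by omega)

/-- If `n < m/2`, then `X_n = X_m (n/m)^κ ≤ X_m (n/m) < X_m / 2`. This converts closeness in space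
into comparability of indices. -/
theorem half_le_of_half_nodeDist_le (hL : 0 < L) (hκ : 1 ≤ κ) (hM : 0 < M) {m n : ℕ}
    (hm : 0 < m) (h : nodeDist L κ M m / 2 ≤ nodeDist L κ M n) : (m : ℝ) / 2 ≤ n := by
  by_contra hlt
  push Not at hlt
  have hm0 : (0 : ℝ) < m := by exact_mod_cast hm
  have hX := nodeDist_pos (κ := κ) hL hM hm
  have h1 : ((n : ℝ) / m) ^ κ ≤ (n : ℝ) / m := by
    refine Real.rpow_le_self_of_le_one (by positivity) ?_ hκ
    rw [div_le_one hm0]; linarith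
  have h2 : (n : ℝ) / m < 1 / 2 := by
    rw [div_lt_div_iff₀ hm0 two_pos]; linarith
  rw [nodeDist_eq_mul (n := n) hM hm] at h
  nlinarith

theorem gradedGrid_of_le (hM : 0 < M) {i : ℕ} (hi : i ≤ M) :
    gradedGrid L κ (2 * M) i = nodeDist L κ M i := by
  have hM0 : (M : ℝ) ≠ 0 := by positivity
  rw [gradedGrid, if_pos (by omega), nodeDist]
  congr 2
  push_cast
  field_simp

theorem gradedGrid_of_ge (hM : 0 < M) {i : ℕ} (hi : M ≤ i) (hi2 : i ≤ 2 * M) :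
    gradedGrid L κ (2 * M) i = 2 * L - nodeDist L κ M (2 * M - i) := by
  have hM0 : (M : ℝ) ≠ 0 := by positivity
  rcases hi.eq_or_lt with rfl | hi
  · rw [gradedGrid_of_le hM le_rfl, show 2 * M - M = M by omega, nodeDist_self hM]; ring
  · rw [gradedGrid, if_neg (by omega), nodeDist]
    congr 3
    rw [Nat.cast_sub hi2]
    push_cast
    field_simp

theorem isMesh_gradedGrid (hL : 0 < L) (hκ : 1 ≤ κ) (hM : 0 < M) :
    IsMesh (gradedGrid L κ (2 * M)) (2 * M) 0 (2 * L) where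
  lt_succ i hi := by
    rcases lt_or_ge i M with h | h
    · rw [gradedGrid_of_le hM h.le, gradedGrid_of_le hM h]
      exact nodeDist_lt hL hκ hM (Nat.lt_succ_self i)
    · rw [gradedGrid_of_ge hM h (by omega), gradedGrid_of_ge hM (by omega) (by omega)]
      have := nodeDist_lt hL hκ hM (show 2 * M - (i + 1) < 2 * M - i by omega)
      linarith
  zero := by rw [gradedGrid_of_le hM (by omega), nodeDist_zero hκ]
  last := by rw [gradedGrid_of_ge hM (by omega) le_rfl, Nat.sub_self, nodeDist_zero hκ, sub_zero]

theorem cell_cases (hM : 0 < M) {j : ℕ} (hj : 1 ≤ j) (hjN : j ≤ 2 * M) :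
    (cellIndex M j = j ∧ j ≤ M ∧ gradedGrid L κ (2 * M) (j - 1) = nodeDist L κ M (cellIndex M j - 1)
      ∧ gradedGrid L κ (2 * M) j = nodeDist L κ M (cellIndex M j)) ∨
    (cellIndex M j = 2 * M + 1 - j ∧ M < j ∧
      gradedGrid L κ (2 * M) (j - 1) = 2 * L - nodeDist L κ M (cellIndex M j)
      ∧ gradedGrid L κ (2 * M) j = 2 * L - nodeDist L κ M (cellIndex M j - 1)) := by
  rcases le_or_gt j M with h | h
  · have hc : cellIndex M j = j := by unfold cellIndex; omega
    left
    refine ⟨hc, h, ?_, ?_⟩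
    · rw [gradedGrid_of_le hM (by omega), hc]
    · rw [gradedGrid_of_le hM (by omega), hc]
  · have hc : cellIndex M j = 2 * M + 1 - j := by unfold cellIndex; omega
    right
    refine ⟨hc, h, ?_, ?_⟩
    · rw [gradedGrid_of_ge hM (by omega) (by omega), hc]; congr 2; omega
    · rw [gradedGrid_of_ge hM (by omega) (by omega), hc]; congr 2; omega

theorem cellIndex_mem {j : ℕ} (hj : 1 ≤ j) (hjN : j ≤ 2 * M) :
    1 ≤ cellIndex M j ∧ cellIndex M j ≤ M := by unfold cellIndex; omega

theorem step_gradedGrid (hM : 0 < M) {j : ℕ} (hj : 1 ≤ j) (hjN : j ≤ 2 * M) :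
    step (gradedGrid L κ (2 * M)) j
      = nodeDist L κ M (cellIndex M j) - nodeDist L κ M (cellIndex M j - 1) := by
  unfold step
  rcases cell_cases (L := L) (κ := κ) hM hj hjN with ⟨-, -, h1, h2⟩ | ⟨-, -, h1, h2⟩ <;>
    rw [h1, h2]
  ring

theorem nodeDist_min_le (hL : 0 < L) (hκ : 1 ≤ κ) (hM : 0 < M) {i : ℕ} (hi : i ≤ 2 * M) :
    nodeDist L κ M (min i (2 * M - i)) ≤ gradedGrid L κ (2 * M) i ∧
      nodeDist L κ M (min i (2 * M - i)) ≤ 2 * L - gradedGrid L κ (2 * M) i ∧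
      (nodeDist L κ M (min i (2 * M - i)) = gradedGrid L κ (2 * M) i ∨
        nodeDist L κ M (min i (2 * M - i)) = 2 * L - gradedGrid L κ (2 * M) i) := by
  have hle := nodeDist_le hL hκ hM (n := min i (2 * M - i)) (by omega)
  rcases le_total i M with h | h
  · rw [gradedGrid_of_le hM h, show min i (2 * M - i) = i by omega] at *
    exact ⟨le_rfl, by linarith, Or.inl rfl⟩
  · rw [gradedGrid_of_ge hM h hi, show min i (2 * M - i) = 2 * M - i by omega] at *
    exact ⟨by linarith, by linarith, Or.inr (by ring)⟩

end Grid

end FastCollocation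

namespace FastCollocation

/-! ### Interpolation error -/

/-- Linear interpolation error under a bound on the second derivative. -/
theorem abs_sub_linear_le {u : ℝ → ℝ} {a b M₂ : ℝ} (hab : a < b)
    (hd : ∀ y ∈ Icc a b, DifferentiableAt ℝ u y)
    (hd2 : ∀ y ∈ Icc a b, DifferentiableAt ℝ (deriv u) y)
    (hM : ∀ y ∈ Icc a b, |deriv (deriv u) y| ≤ M₂) {y : ℝ} (hy : y ∈ Icc a b) :
    |u y - (u a + (u b - u a) * ((y - a) / (b - a)))| ≤ M₂ * (b - a) * |y - a| ∧
      |u y - (u a + (u b - u a) * ((y - a) / (b - a)))| ≤ M₂ * (b - a) * |y - b| := by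
  have hba : 0 < b - a := by linarith
  have hM0 : 0 ≤ M₂ := (abs_nonneg _).trans (hM y hy)
  -- Since `u'` equals the chord slope at `ξ`, it stays within `M₂ (b - a)` of that slope on the
  -- cell. Thus the error is Lipschitz and vanishes at both ends, which gives linear decay at either
  -- node.
  obtain ⟨ξ, hξ, hξs⟩ := exists_deriv_eq_slope u hab
    (fun z hz => (hd z hz).continuousAt.continuousWithinAt)
    (fun z hz => (hd z (Ioo_subset_Icc_self hz)).differentiableWithinAt)
  have hξ' := Ioo_subset_Icc_self hξ
  set s := (u b - u a) / (b - a) with hs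
  have hslope : ∀ η ∈ Icc a b, ‖deriv u η - s‖ ≤ M₂ * (b - a) := by
    intro η hη
    rw [← hξs]
    have := Convex.norm_image_sub_le_of_norm_hasDerivWithin_le (f := deriv u)
      (f' := deriv (deriv u)) (fun z hz => (hd2 z hz).hasDerivAt.hasDerivWithinAt)
      (fun z hz => hM z hz) (convex_Icc a b) hξ' hη
    refine this.trans (mul_le_mul_of_nonneg_left ?_ hM0)
    rw [Real.norm_eq_abs, abs_le]
    constructor <;> linarith [hη.1, hη.2, hξ'.1, hξ'.2]
  have key : ∀ z ∈ Icc a b, |(u y - s * y) - (u z - s * z)| ≤ M₂ * (b - a) * |y - z| := by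
    intro z hz
    exact Convex.norm_image_sub_le_of_norm_hasDerivWithin_le (f := fun y => u y - s * y)
      (f' := fun y => deriv u y - s)
      (fun w hw => by
        have hlin : HasDerivAt (fun y => s * y) s w := by
          simpa using (hasDerivAt_id w).const_mul s
        exact ((hd w hw).hasDerivAt.sub hlin).hasDerivWithinAt)
      hslope (convex_Icc a b) hz hy
  have e1 : u y - (u a + (u b - u a) * ((y - a) / (b - a)))
      = (u y - s * y) - (u a - s * a) := by
    rw [hs]; field_simp; ring
  have e2 : u y - (u a + (u b - u a) * ((y - a) / (b - a)))
      = (u y - s * y) - (u b - s * b) := by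
    rw [hs]; field_simp; ring
  constructor
  · rw [e1]; exact key a ⟨le_rfl, hab.le⟩
  · rw [e2]; exact key b ⟨hab.le, le_rfl⟩

/-- Linear interpolation error on a cell at the boundary, for a function that behaves like a
power of the distance to the boundary. -/
theorem abs_sub_linear_boundary_le {w w' : ℝ → ℝ} {h σ A B : ℝ} (hh : 0 < h) (hσ : 0 < σ)
    (hσ1 : σ < 1) (hA : 0 ≤ A) (hB : 0 ≤ B) (h0 : w 0 = 0)
    (hw : ∀ s, 0 < s → s ≤ h → |w s| ≤ A * s ^ σ)
    (hd : ∀ s, 0 < s → s ≤ h → HasDerivAt w (w' s) s)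
    (hw' : ∀ s, 0 < s → s ≤ h → |w' s| ≤ B * s ^ (σ - 1)) {s : ℝ} (hs : s ∈ Icc 0 h) :
    |w s - w h * (s / h)| ≤ (4 * A + 2 * B) * h ^ σ * ((h - s) / h) := by
  have hq0 : 0 ≤ s / h := div_nonneg hs.1 hh.le
  have hq1 : s / h ≤ 1 := (div_le_one hh).2 hs.2
  have hq : (h - s) / h = 1 - s / h := by field_simp
  have hhσ : 0 < h ^ σ := by positivity
  have hwh := hw h hh le_rfl
  rw [hq]
  set q := s / h with hqdef
  -- On the outer half `(h - s)/h ≥ 1/2`, so bounding the two terms separately suffices. On the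
  -- inner half the derivative is at most `2 B h^(σ-1)`, and the mean value inequality from `h`
  -- supplies the factor `h - s`.
  rcases le_or_gt s (h / 2) with hs2 | hs2
  · have hq2 : q ≤ 1 / 2 := by rw [hqdef, div_le_iff₀ hh]; linarith
    have hws : |w s| ≤ A * h ^ σ := by
      rcases hs.1.eq_or_lt with h1 | h1
      · rw [← h1, h0, abs_zero]; positivity
      · refine (hw s h1 hs.2).trans (mul_le_mul_of_nonneg_left ?_ hA)
        exact Real.rpow_le_rpow hs.1 hs.2 hσ.le
    have h1 : |w h * q| ≤ A * h ^ σ * 1 := by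
      rw [abs_mul, abs_of_nonneg hq0]
      exact mul_le_mul hwh hq1 hq0 (by positivity)
    have h2 : |w s - w h * q| ≤ 2 * (A * h ^ σ) := (abs_sub _ _).trans (by linarith)
    have h3 : 0 ≤ A * h ^ σ := by positivity
    have h4 : 0 ≤ B * h ^ σ := by positivity
    nlinarith
  · have hs0 : 0 < s := by linarith
    have hder : ∀ z ∈ Icc s h, ‖w' z‖ ≤ 2 * B * (h ^ σ / h) := by
      intro z hz
      have hz0 : 0 < z := hs0.trans_le hz.1
      refine (hw' z hz0 hz.2).trans ?_
      have h1 : z ^ (σ - 1) ≤ (h / 2) ^ (σ - 1) :=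
        Real.rpow_le_rpow_of_nonpos (by positivity) (by linarith [hz.1]) (by linarith)
      have h2 : (h / 2) ^ (σ - 1) ≤ 2 * (h ^ σ / h) := by
        rw [Real.div_rpow hh.le two_pos.le, Real.rpow_sub_one hh.ne',
          div_eq_mul_inv _ ((2 : ℝ) ^ (σ - 1)), ← Real.rpow_neg two_pos.le, mul_comm]
        refine mul_le_mul_of_nonneg_right ?_ (by positivity)
        calc (2 : ℝ) ^ (-(σ - 1)) ≤ 2 ^ (1 : ℝ) :=
              Real.rpow_le_rpow_of_exponent_le (by norm_num) (by linarith)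
          _ = 2 := by simp
      calc B * z ^ (σ - 1) ≤ B * (2 * (h ^ σ / h)) := by
            gcongr; exact h1.trans h2
        _ = _ := by ring
    have hmv := Convex.norm_image_sub_le_of_norm_hasDerivWithin_le (f := w) (f' := w')
      (fun z hz => (hd z (hs0.trans_le hz.1) hz.2).hasDerivWithinAt) hder (convex_Icc s h)
      (right_mem_Icc.2 hs.2) (left_mem_Icc.2 hs.2)
    rw [Real.norm_eq_abs, Real.norm_eq_abs, abs_sub_comm s h,
      abs_of_nonneg (show 0 ≤ h - s by linarith [hs.2]),
      show 2 * B * (h ^ σ / h) * (h - s) = 2 * (B * h ^ σ) * (1 - q) by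
        rw [hqdef]; field_simp] at hmv
    have h1 : |w h * (1 - q)| ≤ A * h ^ σ * (1 - q) := by
      rw [abs_mul, abs_of_nonneg (show 0 ≤ 1 - q by linarith)]
      exact mul_le_mul_of_nonneg_right hwh (by linarith)
    have h2 : |w s - w h * q| ≤ 2 * (B * h ^ σ) * (1 - q) + A * h ^ σ * (1 - q) := by
      rw [show w s - w h * q = (w s - w h) + w h * (1 - q) by ring]
      exact (abs_add_le _ _).trans (add_le_add hmv h1)
    have h3 : 0 ≤ A * h ^ σ * (1 - q) := mul_nonneg (by positivity) (by linarith)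
    nlinarith

/-! ### Pointwise bounds extracted from the boundary singularity -/

section Singular

variable {L σ K : ℝ} {u : ℝ → ℝ}

theorem HasBoundarySingularity.nonneg (hu : HasBoundarySingularity 0 (2 * L) σ K u)
    (hL : 0 < L) : 0 ≤ K := by
  have := (abs_nonneg _).trans (hu 0 (by omega) L ⟨hL, by linarith⟩)
  have hp : 0 < ((L - 0) * (2 * L - L)) ^ (σ - ((0 : ℕ) : ℝ)) := by
    apply Real.rpow_pos_of_pos; nlinarith
  exact nonneg_of_mul_nonneg_left this hp

theorem HasBoundarySingularity.abs_le (hu : HasBoundarySingularity 0 (2 * L) σ K u)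
    (hσ : 0 < σ) (hL : 0 < L) {y B : ℝ} (hy : y ∈ Ioo 0 (2 * L)) (hB : y * (2 * L - y) ≤ B) :
    |u y| ≤ K * B ^ σ := by
  have := hu 0 (by omega) y hy
  simp only [iteratedDeriv_zero, sub_zero, Nat.cast_zero] at this
  refine this.trans (mul_le_mul_of_nonneg_left ?_ (hu.nonneg hL))
  exact Real.rpow_le_rpow (mul_nonneg hy.1.le (by linarith [hy.2])) hB hσ.le

theorem HasBoundarySingularity.abs_deriv_le (hu : HasBoundarySingularity 0 (2 * L) σ K u)
    (hσ1 : σ < 1) (hL : 0 < L) {y B : ℝ} (hy : y ∈ Ioo 0 (2 * L)) (hB0 : 0 < B)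
    (hB : B ≤ y * (2 * L - y)) : |deriv u y| ≤ K * B ^ (σ - 1) := by
  have := hu 1 (by omega) y hy
  simp only [iteratedDeriv_one, sub_zero, Nat.cast_one] at this
  refine this.trans (mul_le_mul_of_nonneg_left ?_ (hu.nonneg hL))
  exact Real.rpow_le_rpow_of_nonpos hB0 hB (by linarith)

theorem HasBoundarySingularity.abs_deriv_deriv_le
    (hu : HasBoundarySingularity 0 (2 * L) σ K u)
    (hσ1 : σ < 1) (hL : 0 < L) {y B : ℝ} (hy : y ∈ Ioo 0 (2 * L)) (hB0 : 0 < B)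
    (hB : B ≤ y * (2 * L - y)) : |deriv (deriv u) y| ≤ K * B ^ (σ - 2) := by
  have := hu 2 le_rfl y hy
  rw [iteratedDeriv_succ, iteratedDeriv_one] at this
  simp only [sub_zero, Nat.cast_ofNat] at this
  refine this.trans (mul_le_mul_of_nonneg_left ?_ (hu.nonneg hL))
  exact Real.rpow_le_rpow_of_nonpos hB0 hB (by linarith)

theorem differentiableAt_of_contDiffOn {a b : ℝ} (hc : ContDiffOn ℝ 2 u (Ioo a b)) {y : ℝ}
    (hy : y ∈ Ioo a b) : DifferentiableAt ℝ u y ∧ DifferentiableAt ℝ (deriv u) y := by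
  have h2 : ContDiffOn ℝ (1 + 1) u (Ioo a b) := by simpa [one_add_one_eq_two] using hc
  rw [contDiffOn_succ_iff_deriv_of_isOpen isOpen_Ioo] at h2
  have hn := isOpen_Ioo.mem_nhds hy
  exact ⟨(h2.1 y hy).differentiableAt hn,
    ((h2.2.2.differentiableOn one_ne_zero) y hy).differentiableAt hn⟩

end Singular

end FastCollocation

namespace FastCollocation

/-! ### Interpolation error on the graded grid -/

section Singular

variable {L σ κ K α : ℝ} {u : ℝ → ℝ} {M : ℕ}

/-- Size of the interpolation error on the cells with distance index `n`. -/
noncomputable def cellBound (L κ σ : ℝ) (M n : ℕ) : ℝ := nodeDist L κ M n ^ σ / (n : ℝ) ^ 2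

/-- Constant in the interpolation error bound. -/
noncomputable def interpConst (L κ σ : ℝ) : ℝ :=
  (L / 2 ^ κ) ^ (σ - 2) * κ ^ 2 + (4 * (2 * L) ^ σ + 2 * L ^ (σ - 1))

theorem interpConst_pos (hL : 0 < L) (hκ : 1 ≤ κ) : 0 < interpConst L κ σ := by
  unfold interpConst; positivity

theorem cellBound_nonneg (hL : 0 < L) (n : ℕ) : 0 ≤ cellBound L κ σ M n := by
  unfold cellBound nodeDist; positivity

/-- One of the factors `y`, `2L - y` is at least `L`, the other at least `D`. -/
theorem mul_le_mul_sub {D y : ℝ} (h1 : D ≤ y) (h2 : y ≤ 2 * L - D) (hD : 0 ≤ D) :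
    L * D ≤ y * (2 * L - y) := by
  rcases le_total y L with h | h <;> nlinarith

/-- From the second cell on, `X_(n-1) ≥ 2^(-κ) X_n`, so `u''` is `O(X_n^(σ-2))` on the cell;
multiplication by the squared step `O((X_n/n)^2)` gives `cellBound`. -/
theorem abs_interp_error_inner (hL : 0 < L) (hκ : 1 ≤ κ) (hM : 0 < M) (hσ1 : σ < 1)
    (hc : ContDiffOn ℝ 2 u (Ioo 0 (2 * L))) (hu : HasBoundarySingularity 0 (2 * L) σ K u)
    {n : ℕ} (hn : 2 ≤ n) {a b : ℝ} (hab : b - a = nodeDist L κ M n - nodeDist L κ M (n - 1))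
    (ha : nodeDist L κ M (n - 1) ≤ a) (hb : b ≤ 2 * L - nodeDist L κ M (n - 1))
    {y : ℝ} (hy : y ∈ Icc a b) {q : ℝ} (hq : q = a ∨ q = b) :
    |u y - (u a + (u b - u a) * ((y - a) / (b - a)))|
      ≤ K * interpConst L κ σ * cellBound L κ σ M n * (|y - q| / (b - a)) := by
  have hK := hu.nonneg hL
  set D := nodeDist L κ M (n - 1) with hD
  set X := nodeDist L κ M n with hX
  have hD0 : 0 < D := nodeDist_pos hL hM (by omega)
  have hX0 : 0 < X := nodeDist_pos hL hM (by omega)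
  have hn0 : (0 : ℝ) < n := by exact_mod_cast (show 0 < n by omega)
  have hba : 0 < b - a := by
    rw [hab]; exact sub_pos.2 (nodeDist_lt hL hκ hM (by omega))
  have hba' : b - a ≤ κ * X / n := by rw [hab]; exact nodeDist_sub_le hL hκ hM (by omega)
  have hin : ∀ z ∈ Icc a b, z ∈ Ioo 0 (2 * L) := fun z hz =>
    ⟨by linarith [hz.1], by linarith [hz.2]⟩
  have hest := abs_sub_linear_le (u := u) (M₂ := K * (L * D) ^ (σ - 2)) (by linarith)
    (fun z hz => (differentiableAt_of_contDiffOn hc (hin z hz)).1)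
    (fun z hz => (differentiableAt_of_contDiffOn hc (hin z hz)).2)
    (fun z hz => hu.abs_deriv_deriv_le hσ1 hL (hin z hz) (by positivity)
      (mul_le_mul_sub (ha.trans hz.1) (hz.2.trans hb) hD0.le)) hy
  have h1 : |u y - (u a + (u b - u a) * ((y - a) / (b - a)))|
      ≤ K * (L * D) ^ (σ - 2) * (b - a) * |y - q| := by
    rcases hq with rfl | rfl
    · exact hest.1
    · exact hest.2
  refine h1.trans ?_
  have h2 : (L * D) ^ (σ - 2) ≤ (L / 2 ^ κ) ^ (σ - 2) * X ^ (σ - 2) := by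
    rw [← Real.mul_rpow (by positivity) hX0.le]
    refine Real.rpow_le_rpow_of_nonpos (by positivity) ?_ (by linarith)
    have := nodeDist_le_two_rpow_mul hL hκ hM hn
    rw [← hD, ← hX] at this
    rw [div_mul_eq_mul_div, div_le_iff₀ (by positivity)]
    calc L * X ≤ L * (2 ^ κ * D) := by gcongr
      _ = L * D * 2 ^ κ := by ring
  have h3 : (L * D) ^ (σ - 2) * (b - a) ^ 2 ≤ interpConst L κ σ * cellBound L κ σ M n := by
    calc (L * D) ^ (σ - 2) * (b - a) ^ 2
        ≤ ((L / 2 ^ κ) ^ (σ - 2) * X ^ (σ - 2)) * (κ * X / n) ^ 2 := by gcongr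
      _ = ((L / 2 ^ κ) ^ (σ - 2) * κ ^ 2) * (X ^ σ / n ^ 2) := by
          rw [show X ^ σ = X ^ (σ - 2) * X ^ 2 by
            rw [← Real.rpow_natCast X 2, ← Real.rpow_add hX0]; norm_num]
          ring
      _ ≤ interpConst L κ σ * (X ^ σ / n ^ 2) := by
          gcongr
          unfold interpConst
          have : 0 ≤ 4 * (2 * L) ^ σ + 2 * L ^ (σ - 1) := by positivity
          linarith
  calc K * (L * D) ^ (σ - 2) * (b - a) * |y - q|
      = K * ((L * D) ^ (σ - 2) * (b - a) ^ 2) * (|y - q| / (b - a)) := by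
        field_simp
    _ ≤ K * (interpConst L κ σ * cellBound L κ σ M n) * (|y - q| / (b - a)) := by gcongr
    _ = _ := by ring

/-- On the boundary cell the bound on `u''` blows up, so only `u` and `u'` are controlled. Linear
decay is therefore claimed at the interior node alone. -/
theorem abs_interp_error_left (hL : 0 < L) (hκ : 1 ≤ κ) (hM : 0 < M) (hσ : 0 < σ) (hσ1 : σ < 1)
    (hc : ContDiffOn ℝ 2 u (Ioo 0 (2 * L))) (hu : HasBoundarySingularity 0 (2 * L) σ K u)
    (hu0 : u 0 = 0) {s : ℝ} (hs : s ∈ Icc 0 (nodeDist L κ M 1)) :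
    |u s - u (nodeDist L κ M 1) * (s / nodeDist L κ M 1)|
      ≤ K * interpConst L κ σ * cellBound L κ σ M 1
        * ((nodeDist L κ M 1 - s) / nodeDist L κ M 1) := by
  have hK := hu.nonneg hL
  have hX0 : 0 < nodeDist L κ M 1 := nodeDist_pos hL hM one_pos
  have hX1 : nodeDist L κ M 1 ≤ L := nodeDist_le hL hκ hM hM
  have hin : ∀ z, 0 < z → z ≤ nodeDist L κ M 1 → z ∈ Ioo 0 (2 * L) := fun z h h' =>
    ⟨h, by linarith⟩
  refine (abs_sub_linear_boundary_le (w' := deriv u) (A := K * (2 * L) ^ σ)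
    (B := K * L ^ (σ - 1)) hX0 hσ hσ1 (by positivity) (by positivity) hu0
    (fun z h h' => ?_) (fun z h h' => (differentiableAt_of_contDiffOn hc (hin z h h')).1.hasDerivAt)
    (fun z h h' => ?_) hs).trans ?_
  · rw [mul_assoc, ← Real.mul_rpow (by positivity) h.le]
    exact hu.abs_le hσ hL (hin z h h') (by nlinarith)
  · rw [mul_assoc, ← Real.mul_rpow hL.le h.le]
    exact hu.abs_deriv_le hσ1 hL (hin z h h') (by positivity) (by nlinarith)
  · refine mul_le_mul_of_nonneg_right ?_ (div_nonneg (by linarith [hs.2]) hX0.le)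
    rw [cellBound, Nat.cast_one, one_pow, div_one]
    refine mul_le_mul_of_nonneg_right ?_ (by positivity)
    have : 0 ≤ K * ((L / 2 ^ κ) ^ (σ - 2) * κ ^ 2) := by positivity
    unfold interpConst
    linarith

theorem abs_interp_error_right (hL : 0 < L) (hκ : 1 ≤ κ) (hM : 0 < M) (hσ : 0 < σ) (hσ1 : σ < 1)
    (hc : ContDiffOn ℝ 2 u (Ioo 0 (2 * L))) (hu : HasBoundarySingularity 0 (2 * L) σ K u)
    (huL : u (2 * L) = 0) {s : ℝ} (hs : s ∈ Icc 0 (nodeDist L κ M 1)) :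
    |u (2 * L - s) - u (2 * L - nodeDist L κ M 1) * (s / nodeDist L κ M 1)|
      ≤ K * interpConst L κ σ * cellBound L κ σ M 1
        * ((nodeDist L κ M 1 - s) / nodeDist L κ M 1) := by
  have hK := hu.nonneg hL
  have hX0 : 0 < nodeDist L κ M 1 := nodeDist_pos hL hM one_pos
  have hX1 : nodeDist L κ M 1 ≤ L := nodeDist_le hL hκ hM hM
  have hin : ∀ z, 0 < z → z ≤ nodeDist L κ M 1 → 2 * L - z ∈ Ioo 0 (2 * L) := fun z h h' =>
    ⟨by linarith, by linarith⟩
  refine (abs_sub_linear_boundary_le (w := fun s => u (2 * L - s))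
    (w' := fun s => -deriv u (2 * L - s)) (A := K * (2 * L) ^ σ)
    (B := K * L ^ (σ - 1)) hX0 hσ hσ1 (by positivity) (by positivity) (by simpa using huL)
    (fun z h h' => ?_)
    (fun z h h' => ?_)
    (fun z h h' => ?_) hs).trans ?_
  · rw [mul_assoc, ← Real.mul_rpow (by positivity) h.le]
    exact hu.abs_le hσ hL (hin z h h') (by nlinarith)
  · have h1 := (differentiableAt_of_contDiffOn hc (hin z h h')).1.hasDerivAt
    simpa using h1.comp_const_sub (2 * L) z
  · rw [mul_assoc, ← Real.mul_rpow hL.le h.le, abs_neg]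
    exact hu.abs_deriv_le hσ1 hL (hin z h h') (by positivity) (by nlinarith)
  · refine mul_le_mul_of_nonneg_right ?_ (div_nonneg (by linarith [hs.2]) hX0.le)
    rw [cellBound, Nat.cast_one, one_pow, div_one]
    refine mul_le_mul_of_nonneg_right ?_ (by positivity)
    have : 0 ≤ K * ((L / 2 ^ κ) ^ (σ - 2) * κ ^ 2) := by positivity
    unfold interpConst
    linarith

/-- Interpolation error on a cell, relative to an endpoint `q` in the open interval. -/
theorem abs_interp_error_cell (hL : 0 < L) (hκ : 1 ≤ κ) (hM : 0 < M) (hσ : 0 < σ) (hσ1 : σ < 1)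
    (hc : ContDiffOn ℝ 2 u (Ioo 0 (2 * L))) (hu : HasBoundarySingularity 0 (2 * L) σ K u)
    (hu0 : u 0 = 0) (huL : u (2 * L) = 0) {j : ℕ} (hj : 1 ≤ j) (hjN : j ≤ 2 * M) {y : ℝ}
    (hy : y ∈ Icc (gradedGrid L κ (2 * M) (j - 1)) (gradedGrid L κ (2 * M) j)) {q : ℝ}
    (hq : q = gradedGrid L κ (2 * M) (j - 1) ∨ q = gradedGrid L κ (2 * M) j)
    (hq0 : 0 < q) (hqL : q < 2 * L) :
    |u y - interp (gradedGrid L κ (2 * M)) (2 * M) (fun i => u (gradedGrid L κ (2 * M) i)) y|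
      ≤ K * interpConst L κ σ * cellBound L κ σ M (cellIndex M j)
        * (|y - q| / step (gradedGrid L κ (2 * M)) j) := by
  have hx := isMesh_gradedGrid hL hκ hM
  have hst := step_gradedGrid (L := L) (κ := κ) hM hj hjN
  obtain ⟨hn1, hnM⟩ := cellIndex_mem hj hjN
  have hXL := nodeDist_le hL hκ hM hnM
  rw [hx.interp_eq (by simpa [hx.zero] using hu0) (by simpa [hx.last] using huL) hj hjN hy]
  rcases hn1.eq_or_lt with hn | hn
  · rw [← hn] at hst ⊢
    rw [Nat.sub_self, nodeDist_zero hκ, sub_zero] at hst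
    have hX0 : 0 < nodeDist L κ M 1 := nodeDist_pos hL hM one_pos
    rcases cell_cases (L := L) (κ := κ) hM hj hjN with ⟨-, -, h1, h2⟩ | ⟨-, -, h1, h2⟩ <;>
      rw [← hn] at h1 h2 <;> rw [h1, h2] at hy hq <;> simp only [h1, h2, hst] <;>
      simp only [Nat.sub_self, nodeDist_zero hκ, sub_zero, hu0, huL] at hy hq ⊢
    · have hq' : q = nodeDist L κ M 1 := hq.resolve_left hq0.ne'
      have := abs_interp_error_left hL hκ hM hσ hσ1 hc hu hu0 hy
      rw [hq', abs_sub_comm y, abs_of_nonneg (show 0 ≤ nodeDist L κ M 1 - y by linarith [hy.2]),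
        zero_add]
      exact this
    · have hq' : q = 2 * L - nodeDist L κ M 1 := hq.resolve_right hqL.ne
      have := abs_interp_error_right hL hκ hM hσ hσ1 hc hu huL (s := 2 * L - y)
        ⟨by linarith [hy.2], by linarith [hy.1]⟩
      rw [sub_sub_cancel] at this
      rw [hq', show y - (2 * L - nodeDist L κ M 1) = nodeDist L κ M 1 - (2 * L - y) by ring,
        abs_of_nonneg (show 0 ≤ nodeDist L κ M 1 - (2 * L - y) by linarith [hy.1])]
      refine le_of_eq_of_le (congrArg _ ?_) this
      field_simp
      ring
  · have hD := nodeDist_lt hL hκ hM (show cellIndex M j - 1 < cellIndex M j by omega)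
    refine abs_interp_error_inner hL hκ hM hσ1 hc hu hn ?_ ?_ ?_ hy hq
    · exact hst
    · rcases cell_cases (L := L) (κ := κ) hM hj hjN with ⟨-, -, h1, h2⟩ | ⟨-, -, h1, h2⟩ <;>
        rw [h1]
      linarith
    · rcases cell_cases (L := L) (κ := κ) hM hj hjN with ⟨-, -, h1, h2⟩ | ⟨-, -, h1, h2⟩ <;>
        rw [h2]
      linarith

/-- Because `n/M ≤ 1`, lowering the exponent from `κσ` to `γ` enlarges the power; then `γ - 2 ≤ -α`
and `n ≥ 1`. -/
theorem cellBound_le (hL : 0 < L) (hM : 0 < M) {n : ℕ} (hn : 1 ≤ n)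
    (hnM : n ≤ M) {γ : ℝ} (hγ : γ ≤ κ * σ) (hγ2 : γ ≤ 2 - α) :
    cellBound L κ σ M n ≤ L ^ σ * ((M : ℝ) ^ (-γ) * (n : ℝ) ^ (-α)) := by
  have hM0 : (0 : ℝ) < M := by exact_mod_cast hM
  have hn0 : (0 : ℝ) < n := by exact_mod_cast hn
  have hn1 : (1 : ℝ) ≤ n := by exact_mod_cast hn
  have h1 : nodeDist L κ M n ^ σ ≤ L ^ σ * ((n : ℝ) / M) ^ γ := by
    rw [nodeDist, Real.mul_rpow hL.le (by positivity), ← Real.rpow_mul (by positivity)]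
    refine mul_le_mul_of_nonneg_left ?_ (by positivity)
    exact Real.rpow_le_rpow_of_exponent_ge (by positivity)
      ((div_le_one hM0).2 (by exact_mod_cast hnM)) hγ
  have h2 : ((n : ℝ) / M) ^ γ / (n : ℝ) ^ 2 = (M : ℝ) ^ (-γ) * (n : ℝ) ^ (γ - 2) := by
    rw [Real.div_rpow hn0.le hM0.le, Real.rpow_neg hM0.le, Real.rpow_sub hn0, Real.rpow_two]
    field_simp
  have h3 : (n : ℝ) ^ (γ - 2) ≤ (n : ℝ) ^ (-α) :=
    Real.rpow_le_rpow_of_exponent_le hn1 (by linarith)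
  calc cellBound L κ σ M n ≤ L ^ σ * ((n : ℝ) / M) ^ γ / (n : ℝ) ^ 2 := by
        unfold cellBound; gcongr
    _ = L ^ σ * ((M : ℝ) ^ (-γ) * (n : ℝ) ^ (γ - 2)) := by rw [mul_div_assoc, h2]
    _ ≤ _ := by gcongr

/-- Pointwise interpolation error seen from the node `x_i`. -/
theorem abs_interp_error_le (hL : 0 < L) (hκ : 1 ≤ κ) (hM : 0 < M) (hσ : 0 < σ) (hσ1 : σ < 1)
    (hα : 0 < α) (hα1 : α < 1)
    (hc : ContDiffOn ℝ 2 u (Ioo 0 (2 * L))) (hu : HasBoundarySingularity 0 (2 * L) σ K u)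
    (hext : ∀ y, y ≤ 0 ∨ 2 * L ≤ y → u y = 0) {γ : ℝ} (hγ : γ ≤ κ * σ) (hγ2 : γ ≤ 2 - α)
    {i : ℕ} (hi : i ∈ Finset.Icc 1 (2 * M - 1)) (y : ℝ) :
    |u y - interp (gradedGrid L κ (2 * M)) (2 * M) (fun i => u (gradedGrid L κ (2 * M) i)) y|
      ≤ (4 * K * interpConst L κ σ * L ^ σ * (M : ℝ) ^ (-γ) * ((min i (2 * M - i) : ℕ) : ℝ) ^ (-α))
          * min 1 (|y - gradedGrid L κ (2 * M) i|
            / (nodeDist L κ M (min i (2 * M - i)) / (min i (2 * M - i) : ℕ)))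
        + (4 * K * interpConst L κ σ * L ^ σ * (M : ℝ) ^ (-γ))
          * (if nodeDist L κ M (min i (2 * M - i)) / 2 ≤ |y - gradedGrid L κ (2 * M) i|
              then 1 else 0) := by
  have hK := hu.nonneg hL
  rw [Finset.mem_Icc] at hi
  have hx := isMesh_gradedGrid hL hκ hM
  obtain ⟨hD1, hD2, -⟩ := nodeDist_min_le hL hκ hM (i := i) (by omega)
  set x := gradedGrid L κ (2 * M) with hxdef
  set m := min i (2 * M - i) with hm
  have hm1 : 1 ≤ m := by omega
  have hm0 : (0 : ℝ) < m := by exact_mod_cast hm1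
  set D := nodeDist L κ M m with hD
  have hD0 : 0 < D := nodeDist_pos hL hM hm1
  have hc1 := interpConst_pos (σ := σ) hL hκ
  set P := K * interpConst L κ σ * L ^ σ * (M : ℝ) ^ (-γ) with hP
  have hP0 : 0 ≤ P := by positivity
  rw [show 4 * K * interpConst L κ σ * L ^ σ * (M : ℝ) ^ (-γ) = 4 * P by rw [hP]; ring]
  set t := |y - x i| with ht
  have ht0 : 0 ≤ t := abs_nonneg _
  set r := D / m with hr
  have hr0 : 0 < r := by positivity
  have hmin0 : 0 ≤ min 1 (t / r) := le_min zero_le_one (by positivity)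
  have hfirst : 0 ≤ 4 * P * (m : ℝ) ^ (-α) * min 1 (t / r) := by positivity
  by_cases hy : y ∈ Icc 0 (2 * L)
  swap
  · have hy' : y ≤ 0 ∨ 2 * L ≤ y := by
      simp only [mem_Icc, not_and_or, not_le] at hy
      exact hy.imp le_of_lt le_of_lt
    rw [hext y hy', hx.interp_eq_zero hy', sub_zero, abs_zero]
    positivity
  obtain ⟨j, hj, hjN, hyj⟩ := hx.exists_cell (by omega) hy
  obtain ⟨hn1, hnM⟩ := cellIndex_mem hj hjN
  have hn0 : (0 : ℝ) < cellIndex M j := by exact_mod_cast hn1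
  have hcell := fun q : ℝ => abs_interp_error_cell (q := q) hL hκ hM hσ hσ1 hc hu (hext 0 (Or.inl le_rfl))
    (hext _ (Or.inr le_rfl)) hj hjN hyj
  have hG := cellBound_le (α := α) hL hM hn1 hnM hγ hγ2
  have hG0 := cellBound_nonneg (κ := κ) (σ := σ) (M := M) hL (cellIndex M j)
  have hstep := hx.step_pos hj hjN
  set e := u y - interp x (2 * M) (fun i => u (x i)) y with he
  set Q := K * interpConst L κ σ * cellBound L κ σ M (cellIndex M j) with hQ
  have hQ0 : 0 ≤ Q := by positivity
  have hQP : Q ≤ P * (cellIndex M j : ℝ) ^ (-α) := by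
    calc Q ≤ K * interpConst L κ σ
          * (L ^ σ * ((M : ℝ) ^ (-γ) * (cellIndex M j : ℝ) ^ (-α))) := by
          rw [hQ]; gcongr
      _ = _ := by rw [hP]; ring
  -- Every cell has an endpoint in the open interval, and `|y - q|` does not exceed the step.
  have hunif : |e| ≤ Q := by
    have : ∃ q, (q = x (j - 1) ∨ q = x j) ∧ 0 < q ∧ q < 2 * L := by
      rcases Nat.lt_or_ge 1 j with h | h
      · have := hx.node_mem (m := j - 1) (Finset.mem_Icc.2 ⟨by omega, by omega⟩)
        exact ⟨_, Or.inl rfl, this⟩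
      · have := hx.node_mem (m := j) (Finset.mem_Icc.2 ⟨by omega, by omega⟩)
        exact ⟨_, Or.inr rfl, this⟩
    obtain ⟨q, hq, hq0, hqL⟩ := this
    refine (hcell q hq hq0 hqL).trans (mul_le_of_le_one_right hQ0 ?_)
    rw [div_le_one hstep, step, abs_le]
    rcases hq with rfl | rfl <;> constructor <;> linarith [hyj.1, hyj.2]
  by_cases hfar : D / 2 ≤ t
  · rw [if_pos hfar]
    have h1 : (cellIndex M j : ℝ) ^ (-α) ≤ 1 :=
      Real.rpow_le_one_of_one_le_of_nonpos (by exact_mod_cast hn1) (by linarith)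
    nlinarith
  rw [if_neg hfar, mul_zero, add_zero]
  push Not at hfar
  -- A point within `D/2` of the node is at least `D/2` from the boundary, so its cell index is at
  -- least `m/2`.
  have hnear : (cellIndex M j : ℝ) ^ (-α) ≤ 2 * (m : ℝ) ^ (-α) := by
    have hhalf : (m : ℝ) / 2 ≤ cellIndex M j := by
      refine half_le_of_half_nodeDist_le hL hκ hM hm1 ?_
      rw [ht, abs_lt] at hfar
      rcases cell_cases (L := L) (κ := κ) hM hj hjN with ⟨-, -, h1, h2⟩ | ⟨-, -, h1, h2⟩
      · rw [← h2]; linarith [hyj.2]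
      · have := hyj.1; rw [hxdef, h1] at this; linarith
    calc (cellIndex M j : ℝ) ^ (-α) ≤ ((m : ℝ) / 2) ^ (-α) :=
          Real.rpow_le_rpow_of_nonpos (by positivity) hhalf (by linarith)
      _ = 2 ^ α * (m : ℝ) ^ (-α) := by
          rw [Real.div_rpow hm0.le two_pos.le, Real.rpow_neg two_pos.le, div_inv_eq_mul, mul_comm]
      _ ≤ 2 ^ (1 : ℝ) * (m : ℝ) ^ (-α) := by
          gcongr
          norm_num
      _ = _ := by simp
  have hQm : Q ≤ 2 * P * (m : ℝ) ^ (-α) := by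
    refine hQP.trans ?_
    calc P * (cellIndex M j : ℝ) ^ (-α) ≤ P * (2 * (m : ℝ) ^ (-α)) := by gcongr
      _ = _ := by ring
  -- Cells touching the node have index `m` or `m + 1`, at most `2m`; hence their steps are at least
  -- `D/(2m) = r/2`.
  have hstepr : ∀ k, 1 ≤ k → k ≤ 2 * M → m ≤ cellIndex M k → cellIndex M k ≤ m + 1 →
      r / 2 ≤ step x k := by
    intro k hk hkN h1 h2
    have hk0 := (cellIndex_mem hk hkN).1
    have hk0' : (0 : ℝ) < cellIndex M k := by exact_mod_cast hk0
    rw [hxdef, step_gradedGrid hM hk hkN]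
    refine le_trans ?_ (div_le_nodeDist_sub hL hκ hM hk0)
    have hle : D ≤ nodeDist L κ M (cellIndex M k) := nodeDist_mono hL hκ hM h1
    have hXk : 0 ≤ nodeDist L κ M (cellIndex M k) := hD0.le.trans hle
    have h3 : (cellIndex M k : ℝ) ≤ 2 * m := by exact_mod_cast (show cellIndex M k ≤ 2 * m by omega)
    calc r / 2 = D / (2 * m) := by rw [hr]; field_simp
      _ ≤ nodeDist L κ M (cellIndex M k) / cellIndex M k := by gcongr
  have hxi := hx.node_mem (m := i) (Finset.mem_Icc.2 hi)
  have hidx : m ≤ cellIndex M i ∧ cellIndex M i ≤ m + 1 ∧ m ≤ cellIndex M (i + 1) ∧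
      cellIndex M (i + 1) ≤ m + 1 := by unfold cellIndex; omega
  suffices h : |e| ≤ 2 * Q * min 1 (t / r) by
    refine h.trans ?_
    calc 2 * Q * min 1 (t / r) ≤ 2 * (2 * P * (m : ℝ) ^ (-α)) * min 1 (t / r) := by gcongr
      _ = _ := by ring
  by_cases hadj : j = i ∨ j = i + 1
  · have hq : x i = x (j - 1) ∨ x i = x j := by
      rcases hadj with rfl | rfl
      · right; rfl
      · left; rw [Nat.add_sub_cancel]
    have h1 := hcell _ hq hxi.1 hxi.2
    have h2 : r / 2 ≤ step x j := by
      rcases hadj with rfl | rfl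
      · exact hstepr _ hj hjN hidx.1 hidx.2.1
      · exact hstepr _ hj hjN hidx.2.2.1 hidx.2.2.2
    rw [mul_assoc, mul_min_of_nonneg _ _ hQ0, mul_min_of_nonneg _ _ two_pos.le]
    refine le_min (by linarith) (h1.trans ?_)
    calc Q * (t / step x j) ≤ Q * (t / (r / 2)) := by gcongr
      _ = 2 * (Q * (t / r)) := by field_simp
  -- Outside the adjacent cells a whole adjacent step separates `y` from the node, so the minimum is
  -- at least `1/2` and the uniform bound suffices.
  · have h2 : r / 2 ≤ t := by
      rw [not_or] at hadj
      rcases Nat.lt_or_ge j i with h | h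
      · refine (hstepr i hi.1 (by omega) hidx.1 hidx.2.1).trans ?_
        have := hx.le_of_le (show j ≤ i - 1 by omega) (by omega)
        rw [ht, abs_sub_comm]
        refine le_trans ?_ (le_abs_self _)
        unfold step
        linarith [hyj.2]
      · refine (hstepr (i + 1) (by omega) (by omega) hidx.2.2.1 hidx.2.2.2).trans ?_
        have := hx.le_of_le (show i + 1 ≤ j - 1 by omega) (by omega)
        refine le_trans ?_ (le_abs_self _)
        simp only [step, Nat.add_sub_cancel]
        linarith [hyj.1]
    have h3 : 1 / 2 ≤ min 1 (t / r) := by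
      refine le_min (by norm_num) ?_
      rw [le_div_iff₀ hr0]; linarith
    nlinarith

end Singular

end FastCollocation

namespace FastCollocation

/-! ### Convergence of the scheme on the graded grid -/

/-- Constant in the error bound of the scheme. -/
noncomputable def errorConst (α L σ κ K : ℝ) : ℝ :=
  2 * α * (8 * (4 * |K| * interpConst L κ σ * L ^ σ) * (1 / (1 - α) + 3 / α)
    + 2 * L * L ^ α * (|K| * (L ^ 2) ^ σ)) + 1

theorem errorConst_pos {α L σ κ K : ℝ} (hα : 0 < α) (hα1 : α < 1) (hL : 0 < L) (hκ : 1 ≤ κ) :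
    0 < errorConst α L σ κ K := by
  have := interpConst_pos (σ := σ) hL hκ
  have : 0 < 1 - α := by linarith
  unfold errorConst
  positivity

/-- The hypothesis on `a * b` encodes the cancellation `m^(-α) (D/m)^(-α) = D^(-α)`, which makes the
near-field bound independent of `m` apart from the weight. -/
theorem profile_bound_le {α W μ n a b c d S : ℝ} (hα : 0 < α) (hα1 : α < 1) (hW : 0 ≤ W)
    (hμ : 0 ≤ μ) (hn : 0 ≤ n) (hd : 0 ≤ d) (e1 : a * b = d) (e2 : c ≤ 2 * d) (e3 : μ ≤ 4 * n)
    (hS : d ≤ S) :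
    2 * (W * μ * a * (b * (1 / (1 - α) + 1 / α)) + W * μ * (c / α))
      ≤ 8 * W * (1 / (1 - α) + 3 / α) * n * S := by
  have hα1' : 0 < 1 - α := by linarith
  calc 2 * (W * μ * a * (b * (1 / (1 - α) + 1 / α)) + W * μ * (c / α))
      = 2 * (W * μ) * ((a * b) * (1 / (1 - α) + 1 / α) + c / α) := by ring
    _ ≤ 2 * (W * μ) * (d * (1 / (1 - α) + 1 / α) + 2 * d / α) := by rw [e1]; gcongr
    _ ≤ 2 * (W * (4 * n)) * (d * (1 / (1 - α) + 1 / α) + 2 * d / α) := by gcongr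
    _ = 8 * W * (1 / (1 - α) + 3 / α) * n * d := by ring
    _ ≤ _ := by gcongr

theorem combined_bound_le {α C P R n ε S : ℝ} (hα : 0 < α) (hC : 0 < C) (hε : 0 ≤ ε)
    (hP : 0 ≤ P) (hR : 0 ≤ R) (hn : 0 ≤ n) (hS : 0 ≤ S) :
    C * (P * n * S + R * ε * S) ≤ (2 * α * (P + R) + 1) * (n + ε) * (C * S / (2 * α)) := by
  calc C * (P * n * S + R * ε * S) ≤ C * ((P + R) * (n + ε) * S) := by
        refine mul_le_mul_of_nonneg_left ?_ hC.le
        rw [← add_mul]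
        refine mul_le_mul_of_nonneg_right ?_ hS
        nlinarith [mul_nonneg hP hε, mul_nonneg hR hn]
    _ = 2 * α * (P + R) * (n + ε) * (C * S / (2 * α)) := by field_simp
    _ ≤ _ := by gcongr; linarith

section Singular

variable {α L σ κ K ε Δx X : ℝ} {u f : ℝ → ℝ} {M Ne : ℕ} {lam θ : Fin Ne → ℝ}

theorem truncation_error_gradedGrid (hα : 0 < α) (hα1 : α < 1) (hL : 0 < L) (hκ : 1 ≤ κ)
    (hM : 0 < M) (hσ : 0 < σ) (hσ1 : σ < 1)
    (hc : ContDiffOn ℝ 2 u (Ioo 0 (2 * L))) (hu : HasBoundarySingularity 0 (2 * L) σ K u)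
    (hsol : IsDirichletSolution α 0 (2 * L) f u)
    (hε : 0 ≤ ε) (hX : 2 * L ≤ X)
    (hΔ : ∀ j ∈ Finset.Icc 1 (2 * M), Δx ≤ step (gradedGrid L κ (2 * M)) j)
    (hS : IsSOE (1 + α) ε Δx X Ne lam θ)
    {γ : ℝ} (hγ : γ ≤ κ * σ) (hγ2 : γ ≤ 2 - α) {i : ℕ} (hi : i ∈ Finset.Icc 1 (2 * M - 1)) :
    |fastOp α (gradedGrid L κ (2 * M)) (2 * M) lam θ (fun i => u (gradedGrid L κ (2 * M) i)) i
        - f (gradedGrid L κ (2 * M) i)|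
      ≤ errorConst α L σ κ K * (((2 * M : ℕ) : ℝ) ^ (-γ) + ε)
        * rowWeight α L (gradedGrid L κ (2 * M) i) := by
  have hK := hu.nonneg hL
  have hext : ∀ y, y ≤ 0 ∨ 2 * L ≤ y → u y = 0 := hsol.exterior
  have hi' := Finset.mem_Icc.1 hi
  have hx := isMesh_gradedGrid hL hκ hM
  have hxi := hx.node_mem hi
  obtain ⟨-, -, hDeq⟩ := nodeDist_min_le hL hκ hM (i := i) (by omega)
  have hpt := abs_interp_error_le (K := K) (α := α) hL hκ hM hσ hσ1 hα hα1 hc hu hext hγ hγ2 hi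
  set x := gradedGrid L κ (2 * M) with hxdef
  set m := min i (2 * M - i) with hm
  have hm1 : 1 ≤ m := by omega
  have hm0 : (0 : ℝ) < m := by exact_mod_cast hm1
  have hD0 : 0 < nodeDist L κ M m := nodeDist_pos hL hM hm1
  have hDL : nodeDist L κ M m ≤ L := nodeDist_le hL hκ hM (by omega)
  set D := nodeDist L κ M m with hD
  have hc1 := interpConst_pos (σ := σ) hL hκ
  have hC := normConst_pos hα hα1
  have hα1' : 0 < 1 - α := by linarith
  have hM0 : (0 : ℝ) < M := by exact_mod_cast hM
  set W := 4 * K * interpConst L κ σ * L ^ σ with hW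
  have hW0 : 0 ≤ W := by positivity
  set V := K * (L ^ 2) ^ σ with hVdef
  have hV0 : 0 ≤ V := by positivity
  have hV : ∀ y, |u y| ≤ V := by
    intro y
    by_cases hy : y ∈ Ioo 0 (2 * L)
    · exact hu.abs_le hσ hL hy (by nlinarith [sq_nonneg (y - L)])
    · rw [hext y, abs_zero]
      · exact hV0
      · simp only [mem_Ioo, not_and_or, not_lt] at hy
        exact hy
  have htr := hx.truncation_error hα hα1 hε hX hΔ hS (hext 0 (Or.inl le_rfl))
    (hext _ (Or.inr le_rfl)) hV hi (hsol.eqn _ hxi) (r := D / m) (d := D / 2)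
    (by positivity) (by positivity) (by positivity) (by positivity) hpt
  refine htr.trans ?_
  set S := x i ^ (-α) + (2 * L - x i) ^ (-α) with hSdef
  have hDS : D ^ (-α) ≤ S := by
    have h1 : 0 ≤ x i ^ (-α) := Real.rpow_nonneg hxi.1.le _
    have h2 : 0 ≤ (2 * L - x i) ^ (-α) := Real.rpow_nonneg (by linarith [hxi.2]) _
    rcases hDeq with h | h <;> rw [h] <;> linarith
  -- The weight is bounded below, so the unweighted tolerance error can be absorbed into it.
  have hS1 : 1 ≤ L ^ α * S := by
    have h1 : L ^ (-α) ≤ S :=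
      (Real.rpow_le_rpow_of_nonpos hD0 hDL (by linarith)).trans hDS
    calc (1 : ℝ) = L ^ α * L ^ (-α) := by rw [← Real.rpow_add hL]; simp
      _ ≤ _ := by gcongr
  have e1 : (m : ℝ) ^ (-α) * (D / m) ^ (-α) = D ^ (-α) := by
    rw [← Real.mul_rpow hm0.le (by positivity)]
    congr 1
    field_simp
  have e2 : (D / 2) ^ (-α) ≤ 2 * D ^ (-α) := by
    calc (D / 2) ^ (-α) = 2 ^ α * D ^ (-α) := by
          rw [Real.div_rpow hD0.le two_pos.le, Real.rpow_neg two_pos.le, div_inv_eq_mul, mul_comm]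
      _ ≤ 2 ^ (1 : ℝ) * D ^ (-α) := by
          gcongr
          norm_num
      _ = _ := by simp
  -- Passing from `M` to `N = 2M` costs `2^γ ≤ 4`, as `γ ≤ 2 - α < 2`.
  have e3 : (M : ℝ) ^ (-γ) ≤ 4 * ((2 * M : ℕ) : ℝ) ^ (-γ) := by
    push_cast
    rw [Real.mul_rpow two_pos.le hM0.le, ← mul_assoc]
    refine le_mul_of_one_le_left (by positivity) ?_
    calc (1 : ℝ) = 2 ^ (2 : ℝ) * 2 ^ (-(2 : ℝ)) := by rw [← Real.rpow_add two_pos]; simp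
      _ ≤ 2 ^ (2 : ℝ) * 2 ^ (-γ) := by
          gcongr
          · norm_num
          · linarith
      _ = _ := by norm_num
  have hS0 : 0 ≤ S := (Real.rpow_nonneg hD0.le _).trans hDS
  have hmain : 2 * (W * (M : ℝ) ^ (-γ) * (m : ℝ) ^ (-α)
        * ((D / m) ^ (-α) * (1 / (1 - α) + 1 / α)) + W * (M : ℝ) ^ (-γ) * ((D / 2) ^ (-α) / α))
      ≤ 8 * W * (1 / (1 - α) + 3 / α) * ((2 * M : ℕ) : ℝ) ^ (-γ) * S :=
    profile_bound_le hα hα1 hW0 (by positivity) (by positivity) (Real.rpow_nonneg hD0.le _)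
      e1 e2 e3 hDS
  have hsoe : V * ε * (2 * L) ≤ 2 * L * L ^ α * V * ε * S := by
    calc V * ε * (2 * L) = V * ε * (2 * L) * 1 := by ring
      _ ≤ V * ε * (2 * L) * (L ^ α * S) := by gcongr
      _ = _ := by ring
  have hq : errorConst α L σ κ K = 2 * α * (8 * W * (1 / (1 - α) + 3 / α)
      + 2 * L * L ^ α * V) + 1 := by
    rw [errorConst, abs_of_nonneg hK]
  have hw : rowWeight α L (x i) = normConst α * S / (2 * α) := by
    unfold rowWeight; ring
  rw [hq, hw]
  exact (mul_le_mul_of_nonneg_left (add_le_add hmain hsoe) hC.le).trans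
    (combined_bound_le hα hC hε (by positivity) (by positivity) (by positivity) hS0)

theorem abs_error_le (hα : 0 < α) (hα1 : α < 1) (hL : 0 < L) (hκ : 1 ≤ κ)
    (hM : 0 < M) (hσ : 0 < σ) (hσ1 : σ < 1)
    (hc : ContDiffOn ℝ 2 u (Ioo 0 (2 * L))) (hu : HasBoundarySingularity 0 (2 * L) σ K u)
    (hsol : IsDirichletSolution α 0 (2 * L) f u)
    (hε : 0 ≤ ε) (hε₀ : ε ≤ tolBound α L) (hX : 2 * L ≤ X)
    (hΔ : ∀ j ∈ Finset.Icc 1 (2 * M), Δx ≤ step (gradedGrid L κ (2 * M)) j)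
    (hS : IsSOE (1 + α) ε Δx X Ne lam θ) {U : ℕ → ℝ}
    (hU : IsFastSolution α (gradedGrid L κ (2 * M)) (2 * M) lam θ f U)
    {γ : ℝ} (hγ : γ ≤ κ * σ) (hγ2 : γ ≤ 2 - α) {i : ℕ} (hi : i ≤ 2 * M) :
    |u (gradedGrid L κ (2 * M) i) - U i|
      ≤ errorConst α L σ κ K * (((2 * M : ℕ) : ℝ) ^ (-γ) + ε) := by
  have hx := isMesh_gradedGrid hL hκ hM
  have hpos := errorConst_pos (K := K) (σ := σ) hα hα1 hL hκ
  refine hx.abs_sub_le_of_solution hα hα1 hL hε hε₀ hX hΔ hS hU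
    (v := fun i => u (gradedGrid L κ (2 * M) i)) ?_ ?_ (by positivity) (fun m hm => ?_) i hi
  · simpa only [hx.zero] using hsol.exterior 0 (Or.inl le_rfl)
  · simpa only [hx.last] using hsol.exterior _ (Or.inr le_rfl)
  · exact truncation_error_gradedGrid hα hα1 hL hκ hM hσ hσ1 hc hu hsol hε hX hΔ hS hγ hγ2 hm

end Singular

end FastCollocation

/-! ### Assembly of existence, uniqueness and the three rates -/

theorem theorem3p5 (α L : ℝ) (hα0 : 0 < α) (hα1 : α < 1) (hL : 0 < L) :
    ∃ ε₀ : ℝ, 0 < ε₀ ∧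
      ∀ σ κ K : ℝ, 0 < σ → σ ≤ α / 2 → 1 ≤ κ →
      ∃ c : ℝ, 0 < c ∧
        ∀ u f : ℝ → ℝ,
          ContDiffOn ℝ 2 u (Set.Ioo 0 (2 * L)) →
          FastCollocation.IsDirichletSolution α 0 (2 * L) f u →
          FastCollocation.HasBoundarySingularity 0 (2 * L) σ K u →
        ∀ N : ℕ, 0 < N → Even N →
        ∀ ε : ℝ, 0 < ε → ε ≤ ε₀ →
        ∀ (Δx X : ℝ) (Ne : ℕ) (lam θ : Fin Ne → ℝ),
          0 < Δx →
          (∀ j ∈ Finset.Icc 1 N,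
            Δx ≤ FastCollocation.step (FastCollocation.gradedGrid L κ N) j) →
          2 * L ≤ X →
          FastCollocation.IsSOE (1 + α) ε Δx X Ne lam θ →
        ∃ U : ℕ → ℝ,
          FastCollocation.IsFastSolution α (FastCollocation.gradedGrid L κ N) N lam θ f U ∧
          (∀ V : ℕ → ℝ,
            FastCollocation.IsFastSolution α (FastCollocation.gradedGrid L κ N) N lam θ f V →
            ∀ i ≤ N, V i = U i) ∧
          ∀ i ∈ Finset.Icc 1 (N - 1),
            (κ * (1 + σ) < 2 →
              |u (FastCollocation.gradedGrid L κ N i) - U i|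
                ≤ c * ((N : ℝ) ^ (-(κ * σ)) + ε)) ∧
            (κ * (1 + σ) = 2 →
              |u (FastCollocation.gradedGrid L κ N i) - U i|
                ≤ c * ((N : ℝ) ^ (-(κ * σ)) * Real.log N + ε)) ∧
            (2 < κ * (1 + σ) →
              |u (FastCollocation.gradedGrid L κ N i) - U i|
                ≤ c * ((N : ℝ) ^ (-(min (κ * σ) (2 - α))) + ε)) := by
  refine ⟨FastCollocation.tolBound α L, FastCollocation.tolBound_pos hα0 hL, fun σ κ K hσ hσα hκ => ?_⟩
  have hpos := FastCollocation.errorConst_pos (K := K) (σ := σ) hα0 hα1 hL hκ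
  -- The factor `2` serves the borderline case, where `log N ≥ log 2 ≥ 1/2` must be inserted into a
  -- bound that has no logarithm.
  refine ⟨2 * FastCollocation.errorConst α L σ κ K, by positivity, ?_⟩
  intro u f hc hsol hu N hN hNe ε hε hε₀ Δx X Ne lam θ _ hΔ hX hS
  obtain ⟨M, rfl⟩ := hNe
  rw [← two_mul] at *
  have hM : 0 < M := by omega
  have hx := FastCollocation.isMesh_gradedGrid hL hκ hM
  obtain ⟨U, hU⟩ := hx.exists_solution hα0 hα1 hL hε.le hε₀ hX hΔ hS f
  refine ⟨U, hU, fun V hV i hi => ?_, fun i hi => ?_⟩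
  -- A second solution `V` is compared with `U` as a grid function of zero residual, with `B = 0`.
  · have := hx.abs_sub_le_of_solution hα0 hα1 hL hε.le hε₀ hX hΔ hS hU hV.left hV.right le_rfl
      (fun m hm => by rw [hV.eqn m hm]; simp) i hi
    exact sub_eq_zero.1 (abs_nonpos_iff.1 this)
  have hi' := Finset.mem_Icc.1 hi
  have hmain : ∀ γ : ℝ, γ ≤ κ * σ → γ ≤ 2 - α →
      |u (FastCollocation.gradedGrid L κ (2 * M) i) - U i|
        ≤ FastCollocation.errorConst α L σ κ K * (((2 * M : ℕ) : ℝ) ^ (-γ) + ε) :=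
    fun γ h1 h2 => FastCollocation.abs_error_le hα0 hα1 hL hκ hM hσ (by linarith) hc hu hsol
      hε.le hε₀ hX hΔ hS hU h1 h2 (by omega)
  have hn : ∀ γ : ℝ, 0 ≤ ((2 * M : ℕ) : ℝ) ^ (-γ) := fun γ => by positivity
  refine ⟨fun h => ?_, fun h => ?_, fun _ => ?_⟩
  · refine (hmain (κ * σ) le_rfl (by linarith)).trans ?_
    have := mul_nonneg hpos.le (add_nonneg (hn (κ * σ)) hε.le)
    linarith
  · refine (hmain (κ * σ) le_rfl (by linarith)).trans ?_
    have hlog : 1 / 2 ≤ Real.log ((2 * M : ℕ) : ℝ) := by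
      have h2 : Real.log 2 ≤ Real.log ((2 * M : ℕ) : ℝ) :=
        Real.log_le_log two_pos (by exact_mod_cast (show 2 ≤ 2 * M by omega))
      linarith [Real.log_two_gt_d9]
    have h3 := mul_le_mul_of_nonneg_left hlog (hn (κ * σ))
    calc FastCollocation.errorConst α L σ κ K * (((2 * M : ℕ) : ℝ) ^ (-(κ * σ)) + ε)
        ≤ FastCollocation.errorConst α L σ κ K *
          (2 * (((2 * M : ℕ) : ℝ) ^ (-(κ * σ)) * Real.log ((2 * M : ℕ) : ℝ) + ε)) := by
          gcongr; linarith
      _ = _ := by ring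
  · refine (hmain _ (min_le_left _ _) (min_le_right _ _)).trans ?_
    have := mul_nonneg hpos.le (add_nonneg (hn (min (κ * σ) (2 - α))) hε.le)
    linarith
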